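/- **Setting.** Let $d\ge 1$, $n=2^k$ with $k\ge 0$, $K=\{1,\dots,n\}^d$ and $N=|K|=n^d$. We observe $y_s=\theta^*_s+\sigma\epsilon_s$, $s\in K$, where $\theta^*\in\mathbb R^K$, $\sigma>0$, and the $\epsilon_s$ are independent, have mean zero and satisfy $\max(\mathbb P[\epsilon_s\ge x],\mathbb P[\epsilon_s\le -x])\le 2e^{-x^2/2}$ for all $x\ge 0$. The data are revealed one at a time in a (possibly random) order $\rho(1),\dots,\rho(N)$, an enumeration of $K$. The order is *non-anticipating*: for every $t$ and $s$, conditionally on $(\rho(1),\dots,\rho(t),y_{\rho(1)},\dots,y_{\rho(t-1)})$, on the event $\{\rho(t)=s\}$ the variable $\epsilon_{\rho(t)}$ has the law of $\epsilon_s$. **The predictor.** A rectangle is a product $\prod_{i=1}^d[a_i,b_i]\subset K$ of nonempty intervals of integers. It is dyadic if each factor is of the form $((a-1)2^j,a2^j]$ with $0\le j\le k$, $1\le a\le 2^{k-j}$. Let $\mathcal S$ be the set of all dyadic rectangles, and for $\lambda>0$ put $T_\lambda(x)=\min\{\max\{x,-\lambda\},\lambda\}$. The OMADRE predictor $\hat\theta^{OM}$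 with truncation parameter $\lambda$ is computed as follows. Start with $w_{S,1}=1/|\mathcal S|$ for $S\in\mathcal S$. In round $t$, after $\rho(t)$ is revealed, let $A_t$ be the set of $S\in\mathcal S$ that contain $\rho(t)$ and, if $t>1$, also contain some $\rho(t')$ with $t'<t$. Let $\hat y^{(S)}_{\rho(t)}$ be the mean of the values $y_{\rho(t')}$ over $t'<t$ with $\rho(t')\in S$ (and $0$ if there are none). Predict $$\hat\theta^{OM}_{\rho(t)}=\frac{\sum_{S\in A_t}w_{S,t}\,T_\lambda(\hat y^{(S)}_{\rho(t)})}{\sum_{S\in A_t}w_{S,t}} .$$ Then $y_{\rho(t)}$ is revealed. With $\ell_{S,t}=(T_\lambda(y_{\rho(t)})-T_\lambda(\hat y^{(S)}_{\rho(t)}))^2$ and $\alpha=\frac1{8\lambda^2}$, set $$w_{S,t+1}=\frac{w_{S,t}e^{-\alpha\ell_{S,t}}}{\sum_{S'\in A_t}w_{S',t}e^{-\alpha\ell_{S',t}}}\sum_{S'\in A_t}w_{S',t}\quad\text{for }S\in A_t,\qquad w_{S,t+1}=w_{S,t}\quad\text{for }S\notin A_t .$$ **Theorem.** There is an absolute constant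 $C>0$ such that, in the above setting, for all $d,n,\theta^*,\sigma$, all noise distributions and non-anticipating orders as above, and all $\lambda>0$ with $\lambda\ge C\max\{\sigma\sqrt{\log N},\|\theta^*\|_\infty\}$, the OMADRE predictor satisfies, simultaneously for every nonempty subset $\mathsf T\subset K$, $$\mathbb E\,\frac1{|\mathsf T|}\sum_{s\in \mathsf T}\big(\hat\theta^{OM}_s-\theta^*_s\big)^2\le\inf_{P,\theta}\Big(\frac1{|\mathsf T|}\sum_{s\in\mathsf T}(\theta^*_s-\theta_s)^2+C\lambda^2\,\frac{|P|}{|\mathsf T|}\,(3\log en)^d\,\log(2^dN)\Big)+\frac{\sigma^2+\lambda^2}{|\mathsf T|^2},$$ where the infimum is over all partitions $P$ of $\mathsf T$ into (arbitrary, not only dyadic) rectangles and all $\theta\in\mathbb R^{\mathsf T}$ that are constant on each member of $P$. -/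

import Mathlib

open MeasureTheory ProbabilityTheory

noncomputable section

/-- The truncation map `T_a(x) = min {max {x, -a}, a}`. -/
def truncate (a x : ℝ) : ℝ := min (max x (-a)) a

section Aggregation

variable {K : Type*} [DecidableEq K] {N : ℕ}

/-- A family of online rules: for every expert `S`, every set `U` of already revealed points and
every new point `s`, a map that turns the data on `U` into a prediction at `s`. -/
def OnlineRule (K : Type*) : Type _ := Finset K → (U : Finset K) → K → (U → ℝ) → ℝ

/-- The online averaging rule: the mean of the revealed data on `U`
(it equals `0` when `U` is empty, since `0 / 0 = 0`). -/
def meanRule (K : Type*) : OnlineRule K := fun _ U _ y => (∑ u, y u) / (U.card : ℝ)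

/-- The points revealed strictly before round `t`. Rounds are numbered `0, …, N - 1`. -/
def revealed (ρ : Fin N ≃ K) (t : Fin N) : Finset K := (Finset.univ.filter (· < t)).image ρ

/-- The prediction of the expert `S` at the point `ρ t` revealed in round `t`. -/
def expertPrediction (r : OnlineRule K) (ρ : Fin N ≃ K) (y : K → ℝ) (S : Finset K) (t : Fin N) :
    ℝ :=
  r S (revealed ρ t ∩ S) (ρ t) (fun u => y u)

/-- The active experts in round `t`: those containing `ρ t` and, unless `t` is the first round,
also some previously revealed point. -/
def activeExperts (𝒮 : Finset (Finset K)) (ρ : Fin N ≃ K) (t : Fin N) : Finset (Finset K) :=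
  𝒮.filter (fun S => ρ t ∈ S ∧ (t.val = 0 ∨ ∃ t' : Fin N, t' < t ∧ ρ t' ∈ S))

/-- The loss `ℓ_{S,t}` of the expert `S` in round `t`, computed on truncated quantities. -/
def expertLoss (r : OnlineRule K) (lam : ℝ) (ρ : Fin N ≃ K) (y : K → ℝ) (S : Finset K)
    (t : Fin N) : ℝ :=
  (truncate lam (y (ρ t)) - truncate lam (expertPrediction r ρ y S t)) ^ 2

/-- `expertWeight r 𝒮 lam ρ y t S` is the weight of the expert `S` at the beginning of round `t`
(hence after `t` updates); the learning rate is `1 / (8 lam²)`. -/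
def expertWeight (r : OnlineRule K) (𝒮 : Finset (Finset K)) (lam : ℝ) (ρ : Fin N ≃ K)
    (y : K → ℝ) : ℕ → Finset K → ℝ
  | 0, _ => 1 / (𝒮.card : ℝ)
  | t + 1, S =>
    if h : t < N then
      if S ∈ activeExperts 𝒮 ρ ⟨t, h⟩ then
        expertWeight r 𝒮 lam ρ y t S
            * Real.exp (-(1 / (8 * lam ^ 2)) * expertLoss r lam ρ y S ⟨t, h⟩)
          / (∑ S' ∈ activeExperts 𝒮 ρ ⟨t, h⟩, expertWeight r 𝒮 lam ρ y t S'
              * Real.exp (-(1 / (8 * lam ^ 2)) * expertLoss r lam ρ y S' ⟨t, h⟩))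
          * ∑ S' ∈ activeExperts 𝒮 ρ ⟨t, h⟩, expertWeight r 𝒮 lam ρ y t S'
      else expertWeight r 𝒮 lam ρ y t S
    else expertWeight r 𝒮 lam ρ y t S

/-- The prediction of the aggregation algorithm in round `t`. -/
def aggregatePrediction (r : OnlineRule K) (𝒮 : Finset (Finset K)) (lam : ℝ) (ρ : Fin N ≃ K)
    (y : K → ℝ) (t : Fin N) : ℝ :=
  ∑ S ∈ activeExperts 𝒮 ρ t,
    expertWeight r 𝒮 lam ρ y t S / (∑ S' ∈ activeExperts 𝒮 ρ t, expertWeight r 𝒮 lam ρ y t S')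
      * truncate lam (expertPrediction r ρ y S t)

/-- The output vector of the aggregation algorithm: its entry at `s` is the prediction made in
the round in which `s` is revealed. -/
def aggregate (r : OnlineRule K) (𝒮 : Finset (Finset K)) (lam : ℝ) (ρ : Fin N ≃ K)
    (y : K → ℝ) (s : K) : ℝ :=
  aggregatePrediction r 𝒮 lam ρ y (ρ.symm s)

end Aggregation

section Dyadic

/-- The lattice `{1, …, n}^d`; an element `i : Fin n` stands for the integer `i + 1`. -/
abbrev Grid (d n : ℕ) : Type := Fin d → Fin n

/-- Axis-aligned rectangles `∏ [a_i, b_i]` of the lattice. -/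
def IsRectangle {d n : ℕ} (R : Finset (Grid d n)) : Prop :=
  ∃ a b : Grid d n, (∀ i, a i ≤ b i) ∧ R = Fintype.piFinset (fun i => Finset.Icc (a i) (b i))

/-- Dyadic sub-intervals `((a - 1) 2^s, a 2^s]` of `[1, 2^k]`, `0 ≤ s ≤ k`, `1 ≤ a ≤ 2^(k-s)`. -/
def IsDyadicInterval {k : ℕ} (I : Finset (Fin (2 ^ k))) : Prop :=
  ∃ s a : ℕ, s ≤ k ∧ 1 ≤ a ∧ a ≤ 2 ^ (k - s) ∧
    I = Finset.univ.filter (fun i => (a - 1) * 2 ^ s < i.val + 1 ∧ i.val + 1 ≤ a * 2 ^ s)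

/-- Dyadic rectangles: products of dyadic intervals. -/
def IsDyadicRectangle {d k : ℕ} (R : Finset (Grid d (2 ^ k))) : Prop :=
  ∃ J : Fin d → Finset (Fin (2 ^ k)), (∀ i, IsDyadicInterval (J i)) ∧ R = Fintype.piFinset J

open Classical in
/-- The finite collection of all dyadic rectangles. -/
def dyadicRectangles (d k : ℕ) : Finset (Finset (Grid d (2 ^ k))) :=
  Finset.univ.filter (fun R => IsDyadicRectangle R)

/-- The OMADRE predictor (online means aggregated over dyadic rectangles) with truncation
parameter `lam`, data `y` and order of revelation `ρ`. -/
def omadre {d k N : ℕ} (lam : ℝ) (ρ : Fin N ≃ Grid d (2 ^ k)) (y : Grid d (2 ^ k) → ℝ) :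
    Grid d (2 ^ k) → ℝ :=
  aggregate (meanRule _) (dyadicRectangles d k) lam ρ y

/-- `P` consists of rectangles. -/
def IsRectangularPartition {d n : ℕ} {T : Finset (Grid d n)} (P : Finpartition T) : Prop :=
  ∀ R ∈ P.parts, IsRectangle R

/-- `θ` is constant on each constituent set of `P`. -/
def IsPiecewiseConstant {d n : ℕ} {T : Finset (Grid d n)} (P : Finpartition T)
    (θ : Grid d n → ℝ) : Prop :=
  ∀ R ∈ P.parts, ∀ s ∈ R, ∀ s' ∈ R, θ s = θ s'

end Dyadic

section Ordering

variable {Ω K : Type*} [MeasurableSpace Ω] [MeasurableSpace K] {N : ℕ}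

/-- The history `(ρ[1:t], y_{ρ[1:t-1]})` at the moment when `ρ t` has been revealed but its
observation has not. -/
def history (y : Ω → K → ℝ) (ρ : Ω → (Fin N ≃ K)) (t : Fin N) (ω : Ω) :
    ({i : Fin N // i ≤ t} → K) × ({i : Fin N // i < t} → ℝ) :=
  (fun i => ρ ω i, fun i => y ω (ρ ω i))

/-- A random ordering `ρ` is non-anticipating if, conditionally on the history
`(ρ[1:t], y_{ρ[1:t-1]})`, the noise `ε_{ρ(t)}` is distributed as `ε_s` on the event `ρ(t) = s`.
The conditional law is expressed by its defining property: integration over the events `A`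
of the history. -/
structure IsNonAnticipating (μ : Measure Ω) (ε : K → Ω → ℝ) (y : Ω → K → ℝ)
    (ρ : Ω → (Fin N ≃ K)) : Prop where
  measurable : ∀ t, Measurable (fun ω => ρ ω t)
  condLaw : ∀ (t : Fin N) (s : K) (A : Set (({i : Fin N // i ≤ t} → K) × ({i : Fin N // i < t} → ℝ)))
    (B : Set ℝ), MeasurableSet A → MeasurableSet B →
    μ {ω | history y ρ t ω ∈ A ∧ ρ ω t = s ∧ ε (ρ ω t) ω ∈ B}
      = μ {ω | history y ρ t ω ∈ A ∧ ρ ω t = s} * μ {ω | ε s ω ∈ B}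

end Ordering

end

/-! The bound is first proved on one dyadic rectangle `S` against one constant `c`, and then summed
over a partition.

Deterministic part. For outcomes and predictions in `[-lam, lam]` the square loss is exponentially
concave at rate `1 / (8 lam²)`. Hence in each round where `S` is active, the logarithm of its weight
grows by at least a multiple of the excess loss of the aggregate over `S`. Weights stay at most one,
so telescoping gives regret `8 lam² log |𝒮|` (`sum_regret_le`). The online mean on `S` in turn loses
to any constant by at most a harmonic sum, of order `lam² log N`. Together these give
`sum_sq_sub_aggregate_le`, for data bounded by `lam`.

Stochastic part (`integral_sum_aggregate_sub_sq_le`). Replacing the truncated observation by `θ*` in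
this regret bound produces cross terms with the truncated noise. The prediction at `s` is a function
of the history, so a non-anticipating order makes the expected cross term factor
(`IsNonAnticipating.integral_aggregate_mul`). The truncated noise is nearly centred: its bias is of
order `σ N⁻²`. Some observation exceeds `lam` with probability of order `N⁻¹`, and then the crude
loss bound `4 lam²` per point is affordable. All this costs `O(lam²)`.

Geometric part. Every rectangle is a disjoint union of at most `(2k+1)^d ≤ (3 log en)^d` dyadic ones
(`IsRectangle.hasDisjointCover`), and there are at most `2^d N` dyadic rectangles. Summing over
pieces (`sum_le_of_dyadicRectangles`) gives the oracle inequality. -/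

/-! ### Truncation. -/

lemma abs_truncate_le {a : ℝ} (ha : 0 ≤ a) (x : ℝ) : |truncate a x| ≤ a := by
  unfold truncate
  rw [abs_le]
  exact ⟨le_min (le_max_right _ _) (by linarith), min_le_right _ _⟩

lemma truncate_eq_self {a x : ℝ} (h : |x| ≤ a) : truncate a x = x := by
  obtain ⟨h1, h2⟩ := abs_le.1 h
  rw [truncate, max_eq_left h1, min_eq_left h2]

lemma abs_truncate_sub_truncate_le (a x y : ℝ) : |truncate a x - truncate a y| ≤ |x - y| := by
  unfold truncate
  refine (abs_min_sub_min_le_max _ _ _ _).trans ?_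
  rw [sub_self, abs_zero, max_eq_left (abs_nonneg _)]
  refine (abs_max_sub_max_le_max _ _ _ _).trans ?_
  rw [sub_self, abs_zero, max_eq_left (abs_nonneg _)]

lemma abs_truncate_sub_self_le {a : ℝ} (ha : 0 ≤ a) (x : ℝ) :
    |truncate a x - x| ≤ max (|x| - a) 0 := by
  unfold truncate
  rcases le_total x (-a) with h | h
  · rw [max_eq_right h, min_eq_left (by linarith), abs_of_nonneg (by linarith),
      abs_of_nonpos (by linarith)]
    exact le_max_of_le_left (by linarith)
  · rw [max_eq_left h]
    rcases le_total x a with h' | h'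
    · rw [min_eq_left h', sub_self, abs_zero]
      exact le_max_right _ _
    · rw [min_eq_right h', abs_of_nonpos (by linarith), abs_of_nonneg (by linarith)]
      exact le_max_of_le_left (by linarith)

lemma measurable_truncate (a : ℝ) : Measurable (truncate a) := by
  unfold truncate
  fun_prop

/-! ### Exponential concavity of the square loss. -/

/-- The second derivative is `-2α (1 - 2αx²) exp(-αx²)`, so the Gaussian is concave between its
inflection points. -/
lemma concaveOn_exp_neg_mul_sq {α b : ℝ} (hα : 0 ≤ α) (hb : 2 * α * b ^ 2 ≤ 1) :
    ConcaveOn ℝ (Set.Icc (-b) b) (fun x => Real.exp (-α * x ^ 2)) := by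
  have h1 : ∀ x : ℝ, HasDerivAt (fun x : ℝ => Real.exp (-α * x ^ 2))
      (Real.exp (-α * x ^ 2) * (-2 * α * x)) x := by
    intro x
    convert ((hasDerivAt_pow 2 x).const_mul (-α)).exp using 1
    push_cast; ring
  have h2 : ∀ x : ℝ, HasDerivAt (fun x : ℝ => Real.exp (-α * x ^ 2) * (-2 * α * x))
      (-2 * α * (1 - 2 * α * x ^ 2) * Real.exp (-α * x ^ 2)) x := by
    intro x
    exact ((h1 x).fun_mul ((hasDerivAt_id' x).const_mul (-2 * α))).congr_deriv (by ring)
  refine concaveOn_of_hasDerivWithinAt2_nonpos (convex_Icc _ _)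
    (fun x _ => (h1 x).continuousAt.continuousWithinAt)
    (fun x _ => (h1 x).hasDerivWithinAt) (fun x _ => (h2 x).hasDerivWithinAt) ?_
  intro x hx
  rw [interior_Icc] at hx
  have hx2 : x ^ 2 ≤ b ^ 2 := sq_le_sq' hx.1.le hx.2.le
  have : 2 * α * x ^ 2 ≤ 1 := le_trans (by gcongr) hb
  have h3 : 0 ≤ 2 * α * (1 - 2 * α * x ^ 2) * Real.exp (-α * x ^ 2) := by
    have : 0 ≤ 1 - 2 * α * x ^ 2 := by linarith
    positivity
  linarith

/-- Exponential concavity of the square loss for bounded predictions and outcomes. -/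
lemma sum_mul_exp_neg_sq_le {ι : Type*} (s : Finset ι) (w p : ι → ℝ) {lam z : ℝ} (hlam : 0 < lam)
    (hw : ∀ i ∈ s, 0 ≤ w i) (hw1 : ∑ i ∈ s, w i = 1) (hp : ∀ i ∈ s, |p i| ≤ lam)
    (hz : |z| ≤ lam) :
    ∑ i ∈ s, w i * Real.exp (-(1 / (8 * lam ^ 2)) * (z - p i) ^ 2)
      ≤ Real.exp (-(1 / (8 * lam ^ 2)) * (z - ∑ i ∈ s, w i * p i) ^ 2) := by
  -- The errors `z - p i` range over `[-2 lam, 2 lam]`, where `2αb² = 1` exactly: this dictates the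
  -- learning rate. The claim is then Jensen's inequality.
  have hc := concaveOn_exp_neg_mul_sq (α := 1 / (8 * lam ^ 2)) (b := 2 * lam) (by positivity)
    (by field_simp; norm_num)
  have := hc.le_map_sum (t := s) (w := w) (p := fun i => z - p i) hw hw1 (by
    intro i hi
    have h1 := abs_le.1 (hp i hi)
    have h2 := abs_le.1 hz
    constructor <;> linarith [h1.1, h1.2, h2.1, h2.2])
  simp only [smul_eq_mul, mul_sub, Finset.sum_sub_distrib, ← Finset.sum_mul, hw1, one_mul] at this
  exact this

/-! ### Regret of exponential weights with experts that are not always active. -/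

section Weights

variable {K : Type*} [DecidableEq K] {N : ℕ} (r : OnlineRule K) {𝒮 : Finset (Finset K)}
  {lam : ℝ} (ρ : Fin N ≃ K) (y : K → ℝ)

lemma mem_activeExperts {S : Finset K} {t : Fin N} : S ∈ activeExperts 𝒮 ρ t ↔
    S ∈ 𝒮 ∧ ρ t ∈ S ∧ (t.val = 0 ∨ ∃ t' : Fin N, t' < t ∧ ρ t' ∈ S) := by
  simp [activeExperts]

lemma activeExperts_subset (t : Fin N) : activeExperts 𝒮 ρ t ⊆ 𝒮 := Finset.filter_subset _ _

lemma expertWeight_pos (h𝒮 : 𝒮.Nonempty) (lam : ℝ) (t : ℕ) (S : Finset K) :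
    0 < expertWeight r 𝒮 lam ρ y t S := by
  induction t generalizing S with
  | zero =>
    rw [expertWeight]
    have : 0 < (𝒮.card : ℝ) := by exact_mod_cast h𝒮.card_pos
    positivity
  | succ t ih =>
    rw [expertWeight]
    split_ifs with h hS
    · refine mul_pos (div_pos (mul_pos (ih S) (Real.exp_pos _)) ?_) ?_
      · exact Finset.sum_pos (fun S' _ => mul_pos (ih S') (Real.exp_pos _)) ⟨S, hS⟩
      · exact Finset.sum_pos (fun S' _ => ih S') ⟨S, hS⟩
    · exact ih S
    · exact ih S

/-- The update only redistributes the mass of the active experts among themselves. This keeps every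
single weight at most one. -/
lemma sum_expertWeight (h𝒮 : 𝒮.Nonempty) (lam : ℝ) (t : ℕ) :
    ∑ S ∈ 𝒮, expertWeight r 𝒮 lam ρ y t S = 1 := by
  induction t with
  | zero =>
    have : (𝒮.card : ℝ) ≠ 0 := by exact_mod_cast h𝒮.card_pos.ne'
    simp [expertWeight, this]
  | succ t ih =>
    by_cases h : t < N
    · rw [← ih, ← Finset.sum_sdiff (activeExperts_subset ρ ⟨t, h⟩),
        ← Finset.sum_sdiff (activeExperts_subset (𝒮 := 𝒮) ρ ⟨t, h⟩)]
      congr 1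
      · refine Finset.sum_congr rfl fun S hS => ?_
        rw [expertWeight, dif_pos h, if_neg (Finset.mem_sdiff.1 hS).2]
      · rcases (activeExperts 𝒮 ρ ⟨t, h⟩).eq_empty_or_nonempty with he | hne
        · simp [he]
        · have hZ : 0 < ∑ S' ∈ activeExperts 𝒮 ρ ⟨t, h⟩, expertWeight r 𝒮 lam ρ y t S'
              * Real.exp (-(1 / (8 * lam ^ 2)) * expertLoss r lam ρ y S' ⟨t, h⟩) :=
            Finset.sum_pos (fun S' _ =>
              mul_pos (expertWeight_pos r ρ y h𝒮 lam t S') (Real.exp_pos _)) hne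
          rw [Finset.sum_congr rfl (g := fun S => expertWeight r 𝒮 lam ρ y t S
            * Real.exp (-(1 / (8 * lam ^ 2)) * expertLoss r lam ρ y S ⟨t, h⟩)
          / (∑ S' ∈ activeExperts 𝒮 ρ ⟨t, h⟩, expertWeight r 𝒮 lam ρ y t S'
              * Real.exp (-(1 / (8 * lam ^ 2)) * expertLoss r lam ρ y S' ⟨t, h⟩))
          * ∑ S' ∈ activeExperts 𝒮 ρ ⟨t, h⟩, expertWeight r 𝒮 lam ρ y t S')]
          · rw [← Finset.sum_mul, ← Finset.sum_div, div_self hZ.ne', one_mul]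
          · intro S hS
            rw [expertWeight, dif_pos h, if_pos hS]
    · simpa [expertWeight, h] using ih

lemma expertWeight_le_one {lam : ℝ} {S : Finset K} (hS : S ∈ 𝒮) (t : ℕ) :
    expertWeight r 𝒮 lam ρ y t S ≤ 1 := by
  rw [← sum_expertWeight r ρ y ⟨S, hS⟩ lam t]
  exact Finset.single_le_sum (f := fun S => expertWeight r 𝒮 lam ρ y t S)
    (fun S' _ => (expertWeight_pos r ρ y ⟨S, hS⟩ lam t S').le) hS

lemma abs_aggregatePrediction_le (hlam : 0 ≤ lam) (t : Fin N) :
    |aggregatePrediction r 𝒮 lam ρ y t| ≤ lam := by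
  unfold aggregatePrediction
  rcases (activeExperts 𝒮 ρ t).eq_empty_or_nonempty with he | hne
  · simpa [he] using hlam
  have hpos := fun S => expertWeight_pos r ρ y (hne.mono (activeExperts_subset ρ t)) lam t S
  have hW := Finset.sum_pos (fun S (_ : S ∈ activeExperts 𝒮 ρ t) => hpos S) hne
  refine (Finset.abs_sum_le_sum_abs _ _).trans ?_
  calc _ ≤ ∑ S ∈ activeExperts 𝒮 ρ t, expertWeight r 𝒮 lam ρ y t S
        / (∑ S' ∈ activeExperts 𝒮 ρ t, expertWeight r 𝒮 lam ρ y t S') * lam := by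
        refine Finset.sum_le_sum fun S _ => ?_
        rw [abs_mul, abs_of_pos (div_pos (hpos S) hW)]
        exact mul_le_mul_of_nonneg_left (abs_truncate_le hlam _) (div_pos (hpos S) hW).le
    _ = lam := by rw [← Finset.sum_mul, ← Finset.sum_div, div_self hW.ne', one_mul]

/-- With `W` the active mass and `Z` the same mass after discounting by the losses, the log-weight
changes by `-αℓ - log (Z / W)`. Exponential concavity bounds `log (Z / W)` by `-α` times the loss of
the aggregate. -/
lemma regret_le_log_expertWeight (hlam : 0 < lam) {S : Finset K} {t : Fin N}
    (hS : S ∈ activeExperts 𝒮 ρ t) :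
    1 / (8 * lam ^ 2) * ((truncate lam (y (ρ t)) - aggregatePrediction r 𝒮 lam ρ y t) ^ 2
        - expertLoss r lam ρ y S t)
      ≤ Real.log (expertWeight r 𝒮 lam ρ y (t + 1) S)
        - Real.log (expertWeight r 𝒮 lam ρ y t S) := by
  have hpos := fun S' => expertWeight_pos r ρ y ⟨S, activeExperts_subset ρ t hS⟩ lam t S'
  have hW := Finset.sum_pos (fun S (_ : S ∈ activeExperts 𝒮 ρ t) => hpos S) ⟨S, hS⟩
  have hZ := Finset.sum_pos (fun S' (_ : S' ∈ activeExperts 𝒮 ρ t) => mul_pos (hpos S')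
    (Real.exp_pos (-(1 / (8 * lam ^ 2)) * expertLoss r lam ρ y S' t))) ⟨S, hS⟩
  have key := sum_mul_exp_neg_sq_le (activeExperts 𝒮 ρ t)
    (fun S => expertWeight r 𝒮 lam ρ y t S
      / (∑ S' ∈ activeExperts 𝒮 ρ t, expertWeight r 𝒮 lam ρ y t S'))
    (fun S => truncate lam (expertPrediction r ρ y S t)) hlam
    (fun S' _ => (div_pos (hpos S') hW).le)
    (by rw [← Finset.sum_div, div_self hW.ne'])
    (fun S' _ => abs_truncate_le hlam.le _) (abs_truncate_le hlam.le (y (ρ t)))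
  simp only [div_mul_eq_mul_div, ← Finset.sum_div] at key
  rw [← Real.log_le_iff_le_exp (div_pos (by simpa [expertLoss] using hZ) hW),
    Real.log_div (by simpa [expertLoss] using hZ.ne') hW.ne'] at key
  rw [expertWeight, dif_pos t.2, if_pos hS,
    Real.log_mul (div_pos (mul_pos (hpos S) (Real.exp_pos _)) hZ).ne' hW.ne',
    Real.log_div (mul_pos (hpos S) (Real.exp_pos _)).ne' hZ.ne',
    Real.log_mul (hpos S).ne' (Real.exp_pos _).ne', Real.log_exp]
  have e1 : aggregatePrediction r 𝒮 lam ρ y t = (∑ S ∈ activeExperts 𝒮 ρ t,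
      expertWeight r 𝒮 lam ρ y t S * truncate lam (expertPrediction r ρ y S t))
      / ∑ S ∈ activeExperts 𝒮 ρ t, expertWeight r 𝒮 lam ρ y t S := by
    simp only [aggregatePrediction, div_mul_eq_mul_div, ← Finset.sum_div]
  rw [← e1] at key
  simp only [expertLoss] at key ⊢
  simp only [div_mul_eq_mul_div, one_mul, neg_mul] at key ⊢
  simp only [sub_div] at key ⊢
  linarith

/-- The log-weight of `S` starts at `-log |𝒮|`, never exceeds zero and is frozen while `S` is
inactive, so the increments telescope over all rounds. -/
lemma sum_regret_le (hlam : 0 < lam) {S : Finset K} (hS : S ∈ 𝒮) :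
    ∑ t with S ∈ activeExperts 𝒮 ρ t,
        (truncate lam (y (ρ t)) - aggregatePrediction r 𝒮 lam ρ y t) ^ 2
      ≤ ∑ t with S ∈ activeExperts 𝒮 ρ t, expertLoss r lam ρ y S t
        + 8 * lam ^ 2 * Real.log 𝒮.card := by
  have h1 : ∑ t with S ∈ activeExperts 𝒮 ρ t,
      1 / (8 * lam ^ 2) * ((truncate lam (y (ρ t)) - aggregatePrediction r 𝒮 lam ρ y t) ^ 2
        - expertLoss r lam ρ y S t)
      ≤ ∑ t : Fin N, (Real.log (expertWeight r 𝒮 lam ρ y (t + 1) S)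
        - Real.log (expertWeight r 𝒮 lam ρ y t S)) := by
    rw [Finset.sum_filter]
    refine Finset.sum_le_sum fun t _ => ?_
    split_ifs with h
    · exact regret_le_log_expertWeight r ρ y hlam h
    · rw [expertWeight, dif_pos t.2, if_neg h, sub_self]
  rw [Fin.sum_univ_eq_sum_range (fun t => Real.log (expertWeight r 𝒮 lam ρ y (t + 1) S)
        - Real.log (expertWeight r 𝒮 lam ρ y t S)) N,
    Finset.sum_range_sub (fun t => Real.log (expertWeight r 𝒮 lam ρ y t S)),
    ← Finset.mul_sum, Finset.sum_sub_distrib] at h1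
  have h2 : Real.log (expertWeight r 𝒮 lam ρ y N S) ≤ 0 :=
    Real.log_nonpos (expertWeight_pos r ρ y ⟨S, hS⟩ lam N S).le (expertWeight_le_one r ρ y hS N)
  have h3 : Real.log (expertWeight r 𝒮 lam ρ y 0 S) = - Real.log 𝒮.card := by
    rw [expertWeight, one_div, Real.log_inv]
  rw [h3, one_div, inv_mul_le_iff₀ (by positivity)] at h1
  nlinarith [sq_nonneg lam]

end Weights

/-! ### Online averaging against constants. -/

/-- The left side is the sum of squares about the mean; the gap is `|U| (mean - c)²`. -/
lemma sum_sq_sub_mean_le {K : Type*} (U : Finset K) (f : K → ℝ) (c : ℝ) :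
    ∑ u ∈ U, f u ^ 2 - (∑ u ∈ U, f u) ^ 2 / U.card ≤ ∑ u ∈ U, (f u - c) ^ 2 := by
  rcases U.eq_empty_or_nonempty with rfl | hU
  · simp
  have hm : 0 < (U.card : ℝ) := by exact_mod_cast hU.card_pos
  have h : ∑ u ∈ U, (f u - c) ^ 2 = ∑ u ∈ U, f u ^ 2 - 2 * c * ∑ u ∈ U, f u + U.card * c ^ 2 := by
    simp only [sub_sq, Finset.sum_add_distrib, Finset.sum_sub_distrib, Finset.sum_const,
      nsmul_eq_mul, Finset.mul_sum]
    congr 2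
    exact Finset.sum_congr rfl fun u _ => by ring
  have h2 : 0 ≤ (∑ u ∈ U, f u - U.card * c) ^ 2 / U.card := by positivity
  have h3 : (∑ u ∈ U, f u - U.card * c) ^ 2 / U.card
      = (∑ u ∈ U, f u) ^ 2 / U.card - 2 * c * ∑ u ∈ U, f u + U.card * c ^ 2 := by
    field_simp
    ring
  linarith

lemma abs_mean_le {K : Type*} {U : Finset K} {f : K → ℝ} {b : ℝ} (hb : 0 ≤ b) (hf : ∀ u, |f u| ≤ b) :
    |(∑ u ∈ U, f u) / U.card| ≤ b := by
  rcases U.eq_empty_or_nonempty with rfl | hU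
  · simpa
  have hm : 0 < (U.card : ℝ) := by exact_mod_cast hU.card_pos
  rw [abs_div, abs_of_pos hm, div_le_iff₀ hm, mul_comm, ← nsmul_eq_mul]
  exact (Finset.abs_sum_le_sum_abs _ _).trans (Finset.sum_le_card_nsmul _ _ _ fun u _ => hf u)

section OnlineMean

variable {K : Type*} [DecidableEq K]

/-- Adding a point to `m` others raises the sum of squares about the mean by `m / (m + 1)` times the
squared prediction error. The missing fraction `1 / (m + 1)` is what accumulates to a harmonic sum.
-/
lemma sq_sub_mean_eq (U : Finset K) (hU : U.Nonempty) {x : K} (hx : x ∉ U) (f : K → ℝ) :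
    (f x - (∑ u ∈ U, f u) / U.card) ^ 2
      = (∑ u ∈ insert x U, f u ^ 2 - (∑ u ∈ insert x U, f u) ^ 2 / (insert x U).card)
        - (∑ u ∈ U, f u ^ 2 - (∑ u ∈ U, f u) ^ 2 / U.card)
        + (f x - (∑ u ∈ U, f u) / U.card) ^ 2 / ((U.card : ℝ) + 1) := by
  have hm : (U.card : ℝ) ≠ 0 := by exact_mod_cast hU.card_pos.ne'
  have hm1 : (U.card : ℝ) + 1 ≠ 0 := by positivity
  rw [Finset.sum_insert hx, Finset.sum_insert hx, Finset.card_insert_of_notMem hx]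
  push_cast
  field_simp
  ring

variable {N : ℕ}

lemma expertPrediction_meanRule (ρ : Fin N ≃ K) (y : K → ℝ) (S : Finset K) (t : Fin N) :
    expertPrediction (meanRule K) ρ y S t
      = (∑ u ∈ revealed ρ t ∩ S, y u) / (revealed ρ t ∩ S).card := by
  unfold expertPrediction meanRule
  rw [Finset.sum_coe_sort (revealed ρ t ∩ S) y]

/-- The points revealed in the first `j` rounds that lie in `S`. -/
def revealedIn (ρ : Fin N ≃ K) (S : Finset K) (j : ℕ) : Finset K :=
  (Finset.univ.filter (fun t : Fin N => t.val < j)).image ρ ∩ S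

lemma mem_revealedIn {ρ : Fin N ≃ K} {S : Finset K} {j : ℕ} {s : K} :
    s ∈ revealedIn ρ S j ↔ (ρ.symm s).val < j ∧ s ∈ S := by
  simp only [revealedIn, Finset.mem_inter, Finset.mem_image, Finset.mem_filter, Finset.mem_univ,
    true_and]
  refine and_congr_left fun _ => ⟨?_, fun h => ⟨_, h, by simp⟩⟩
  rintro ⟨t, ht, rfl⟩
  simpa using ht

lemma revealed_inter_eq (ρ : Fin N ≃ K) (S : Finset K) (t : Fin N) :
    revealed ρ t ∩ S = revealedIn ρ S t := rfl

lemma revealedIn_card (ρ : Fin N ≃ K) (S : Finset K) : revealedIn ρ S N = S := by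
  ext s
  simp [mem_revealedIn]

lemma revealedIn_succ (ρ : Fin N ≃ K) (S : Finset K) (t : Fin N) :
    revealedIn ρ S (t + 1) = if ρ t ∈ S then insert (ρ t) (revealedIn ρ S t)
      else revealedIn ρ S t := by
  ext s
  have h : (ρ.symm s).val = t.val ↔ s = ρ t := by
    rw [Fin.val_inj, Equiv.symm_apply_eq]
  split_ifs with hS
  · rw [Finset.mem_insert, mem_revealedIn, mem_revealedIn, Nat.lt_succ_iff_lt_or_eq, h]
    constructor
    · tauto
    · rintro (rfl | h) <;> tauto
  · rw [mem_revealedIn, mem_revealedIn, Nat.lt_succ_iff_lt_or_eq, h]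
    constructor
    · rintro ⟨h1 | rfl, h2⟩
      · exact ⟨h1, h2⟩
      · exact absurd h2 hS
    · tauto

/-- The online averaging rule competes with constants. -/
lemma sum_sq_sub_expertPrediction_meanRule_le (ρ : Fin N ≃ K) (y : K → ℝ) {lam : ℝ}
    (hlam : 0 ≤ lam) (hy : ∀ s, |y s| ≤ lam) (S : Finset K) (c : ℝ) :
    ∑ t with ρ t ∈ S ∧ (revealedIn ρ S t).Nonempty,
        (y (ρ t) - expertPrediction (meanRule K) ρ y S t) ^ 2
      ≤ ∑ s ∈ S, (y s - c) ^ 2 + 4 * lam ^ 2 * (1 + Real.log N) := by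
  -- Invariant after `j` rounds: the loss so far is at most the sum of squares about the current
  -- mean plus `4 lam²` times the harmonic number of the points seen in `S`.
  have key : ∀ j ≤ N, ∑ t : Fin N with t.val < j,
      (if ρ t ∈ S ∧ (revealedIn ρ S t).Nonempty then
        (y (ρ t) - expertPrediction (meanRule K) ρ y S t) ^ 2 else 0)
      ≤ (∑ u ∈ revealedIn ρ S j, y u ^ 2
          - (∑ u ∈ revealedIn ρ S j, y u) ^ 2 / (revealedIn ρ S j).card)
        + 4 * lam ^ 2 * harmonic (revealedIn ρ S j).card := by
    intro j
    induction j with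
    | zero => intro _; simp [revealedIn]
    | succ j ih =>
      intro hj
      have hj' : j < N := hj
      have hf : (Finset.univ.filter fun t : Fin N => t.val < j + 1)
          = insert ⟨j, hj'⟩ (Finset.univ.filter fun t : Fin N => t.val < j) := by
        ext t
        simp [Fin.ext_iff]
        omega
      rw [hf, Finset.sum_insert (by simp)]
      have hs := revealedIn_succ ρ S ⟨j, hj'⟩
      simp only at hs
      have ih := ih hj'.le
      by_cases hS : ρ ⟨j, hj'⟩ ∈ S
      · rw [if_pos hS] at hs
        have hx : ρ ⟨j, hj'⟩ ∉ revealedIn ρ S j := by simp [mem_revealedIn]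
        rw [hs, Finset.card_insert_of_notMem hx, harmonic_succ]
        by_cases hne : (revealedIn ρ S j).Nonempty
        · rw [if_pos ⟨hS, hne⟩, expertPrediction_meanRule, revealed_inter_eq]
          have h1 := sq_sub_mean_eq _ hne hx y
          rw [Finset.card_insert_of_notMem hx] at h1
          have h2 : (y (ρ ⟨j, hj'⟩)
              - (∑ u ∈ revealedIn ρ S j, y u) / (revealedIn ρ S j).card) ^ 2 ≤ (2 * lam) ^ 2 := by
            have a1 := abs_le.1 (hy (ρ ⟨j, hj'⟩))
            have a2 := abs_le.1 (abs_mean_le (U := revealedIn ρ S j) hlam hy)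
            exact sq_le_sq' (by linarith [a1.1, a2.2]) (by linarith [a1.2, a2.1])
          have h3 : (y (ρ ⟨j, hj'⟩)
              - (∑ u ∈ revealedIn ρ S j, y u) / (revealedIn ρ S j).card) ^ 2
                / ((revealedIn ρ S j).card + 1) ≤ (2 * lam) ^ 2 / ((revealedIn ρ S j).card + 1) := by
            exact div_le_div_of_nonneg_right h2 (add_nonneg (Nat.cast_nonneg _) zero_le_one)
          push_cast at h1 ⊢
          have h4 : (2 * lam) ^ 2 / ((revealedIn ρ S j).card + 1 : ℝ)
            = 4 * lam ^ 2 * ((revealedIn ρ S j).card + 1 : ℝ)⁻¹ := by ring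
          linarith
        -- On the first visit to `S` no loss is counted, and a single point has zero sum of squares
        -- about its mean.
        · rw [if_neg (fun h => hne h.2)]
          rw [Finset.not_nonempty_iff_eq_empty] at hne
          rw [hne, Finset.card_empty, harmonic_zero] at ih
          rw [hne, Finset.card_empty, harmonic_zero, Finset.sum_insert (Finset.notMem_empty _),
            Finset.sum_insert (Finset.notMem_empty _)]
          rw [zero_add]
          refine ih.trans ?_
          have : 0 ≤ lam ^ 2 := sq_nonneg lam
          simp [this]
      · rw [if_neg hS] at hs
        rw [hs, if_neg (fun h => hS h.1), zero_add]
        exact ih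
  have h := key N le_rfl
  rw [revealedIn_card, Finset.filter_true_of_mem (fun t _ => t.2), ← Finset.sum_filter] at h
  refine h.trans (add_le_add (sum_sq_sub_mean_le S y c) ?_)
  refine mul_le_mul_of_nonneg_left ?_ (by positivity)
  rcases S.eq_empty_or_nonempty with rfl | hS
  · simp
    have := Real.log_natCast_nonneg N
    linarith
  refine (harmonic_le_one_add_log _).trans ?_
  have hc : S.card ≤ N := by
    have h1 := Finset.card_le_card (Finset.subset_univ (S.map ρ.symm.toEmbedding))
    simpa using h1
  have : (S.card : ℝ) ≤ N := by exact_mod_cast hc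
  have h0 : (0 : ℝ) < S.card := by exact_mod_cast hS.card_pos
  linarith [Real.log_le_log h0 this]

lemma abs_expertPrediction_meanRule_le (ρ : Fin N ≃ K) {y : K → ℝ} {lam : ℝ}
    (hlam : 0 ≤ lam) (hy : ∀ s, |y s| ≤ lam) (S : Finset K) (t : Fin N) :
    |expertPrediction (meanRule K) ρ y S t| ≤ lam := by
  rw [expertPrediction_meanRule]
  exact abs_mean_le hlam hy

lemma sum_mem_eq_sum_rounds (ρ : Fin N ≃ K) (S : Finset K) (f : K → ℝ) :
    ∑ s ∈ S, f s = ∑ t with ρ t ∈ S, f (ρ t) := by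
  refine Finset.sum_nbij' ρ.symm ρ ?_ ?_ ?_ ?_ ?_ <;> simp

/-- Regret of the aggregated online means on an expert set, for bounded data. -/
lemma sum_sq_sub_aggregate_le {𝒮 : Finset (Finset K)} (ρ : Fin N ≃ K) (y : K → ℝ) {lam : ℝ}
    (hlam : 0 < lam) (hy : ∀ s, |y s| ≤ lam) {S : Finset K} (hS : S ∈ 𝒮) (c : ℝ) :
    ∑ s ∈ S, (y s - aggregate (meanRule K) 𝒮 lam ρ y s) ^ 2
      ≤ ∑ s ∈ S, (y s - c) ^ 2
        + lam ^ 2 * (8 * Real.log 𝒮.card + 4 * Real.log N + 12) := by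
  set p := aggregatePrediction (meanRule K) 𝒮 lam ρ y with hp
  set D := Finset.univ.filter fun t => ρ t ∈ S with hD
  set A := Finset.univ.filter fun t => S ∈ activeExperts 𝒮 ρ t with hA
  set B := Finset.univ.filter fun t => ρ t ∈ S ∧ (revealedIn ρ S t).Nonempty with hB
  have hAD : A ⊆ D := fun t ht => by
    simp only [hA, hD, Finset.mem_filter, Finset.mem_univ, true_and, mem_activeExperts] at ht ⊢
    exact ht.2.1
  have hBA : B ⊆ A := fun t ht => by
    simp only [hA, hB, Finset.mem_filter, Finset.mem_univ, true_and, mem_activeExperts] at ht ⊢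
    obtain ⟨h1, s, hs⟩ := ht
    rw [mem_revealedIn] at hs
    exact ⟨hS, h1, Or.inr ⟨ρ.symm s, hs.1, by simpa using hs.2⟩⟩
  -- Only the first visit to `S` can be missing from `B`. It costs at most `4 lam²` for the
  -- aggregate (if `S` is inactive) and `4 lam²` for the expert (if active in round zero). With the
  -- `4 lam²` from the harmonic sum this makes the constant 12.
  have hcard : (D \ B).card ≤ 1 := by
    rw [Finset.card_le_one]
    have hlt : ∀ t ∈ D, ∀ t' ∈ D \ B, ¬ t < t' := by
      intro t ht t' ht' hlt
      simp only [hB, hD, Finset.mem_filter, Finset.mem_univ, true_and, Finset.mem_sdiff] at ht ht'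
      exact ht'.2 ⟨ht'.1, ρ t, mem_revealedIn.2 ⟨by simpa using hlt, ht⟩⟩
    intro t ht t' ht'
    exact le_antisymm (not_lt.1 (hlt _ (Finset.mem_sdiff.1 ht').1 _ ht))
      (not_lt.1 (hlt _ (Finset.mem_sdiff.1 ht).1 _ ht'))
  have hbound : ∀ (E : Finset (Fin N)) (f : Fin N → ℝ), E ⊆ D \ B →
      (∀ t, f t ≤ 4 * lam ^ 2) → ∑ t ∈ E, f t ≤ 4 * lam ^ 2 := by
    intro E f hE hf
    refine (Finset.sum_le_card_nsmul _ _ _ fun t _ => hf t).trans ?_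
    rw [nsmul_eq_mul]
    have : (E.card : ℝ) ≤ 1 := by exact_mod_cast (Finset.card_le_card hE).trans hcard
    nlinarith [sq_nonneg lam]
  have hsq : ∀ a b : ℝ, |a| ≤ lam → |b| ≤ lam → (a - b) ^ 2 ≤ 4 * lam ^ 2 := by
    intro a b ha hb
    rw [abs_le] at ha hb
    calc (a - b) ^ 2 ≤ (2 * lam) ^ 2 := sq_le_sq' (by linarith [ha.1, hb.2])
          (by linarith [ha.2, hb.1])
      _ = _ := by ring
  have h1 := sum_regret_le (meanRule K) ρ y hlam hS
  have h2 := sum_sq_sub_expertPrediction_meanRule_le ρ y hlam.le hy S c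
  have hty : ∀ s, truncate lam (y s) = y s := fun s => truncate_eq_self (hy s)
  have hl : ∀ t, expertLoss (meanRule K) lam ρ y S t
      = (y (ρ t) - expertPrediction (meanRule K) ρ y S t) ^ 2 := fun t => by
    rw [expertLoss, hty, truncate_eq_self (abs_expertPrediction_meanRule_le ρ hlam.le hy S t)]
  simp only [hty, hl] at h1
  rw [sum_mem_eq_sum_rounds ρ S (fun s => (y s - aggregate (meanRule K) 𝒮 lam ρ y s) ^ 2)]
  simp only [aggregate, Equiv.symm_apply_apply]
  rw [← Finset.sum_sdiff hAD]
  have h3 := hbound (D \ A) (fun t => (y (ρ t) - p t) ^ 2)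
    (Finset.sdiff_subset_sdiff le_rfl hBA)
    (fun t => hsq _ _ (hy _) (abs_aggregatePrediction_le _ _ _ hlam.le _))
  have h4 := hbound (A \ B) (fun t => (y (ρ t) - expertPrediction (meanRule K) ρ y S t) ^ 2)
    (Finset.sdiff_subset_sdiff hAD le_rfl)
    (fun t => hsq _ _ (hy _) (abs_expertPrediction_meanRule_le ρ hlam.le hy S t))
  have h5 := Finset.sum_sdiff hBA
    (f := fun t => (y (ρ t) - expertPrediction (meanRule K) ρ y S t) ^ 2)
  linarith

end OnlineMean

/-! ### Covering rectangles by dyadic rectangles. -/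

section DisjointCover

variable {α : Type*} [DecidableEq α]

/-- `U` is the disjoint union of at most `m` finite sets satisfying `p`. -/
def HasDisjointCover (p : Finset α → Prop) (U : Finset α) (m : ℕ) : Prop :=
  ∃ 𝒟 : Finset (Finset α), (∀ I ∈ 𝒟, p I) ∧ (𝒟 : Set (Finset α)).PairwiseDisjoint id ∧
    𝒟.biUnion id = U ∧ 𝒟.card ≤ m

lemma HasDisjointCover.empty (p : Finset α → Prop) (m : ℕ) : HasDisjointCover p ∅ m :=
  ⟨∅, by simp, by simp, by simp, by simp⟩

lemma HasDisjointCover.mono {p : Finset α → Prop} {U U' : Finset α} {m m' : ℕ}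
    (h : HasDisjointCover p U m) (hU : U = U') (hm : m ≤ m') : HasDisjointCover p U' m' := by
  obtain ⟨𝒟, h1, h2, h3, h4⟩ := h
  exact ⟨𝒟, h1, h2, h3.trans hU, h4.trans hm⟩

lemma HasDisjointCover.union {p : Finset α → Prop} {U I : Finset α} {m : ℕ}
    (h : HasDisjointCover p U m) (hI : p I) (hd : Disjoint I U) :
    HasDisjointCover p (I ∪ U) (m + 1) := by
  obtain ⟨𝒟, h1, h2, h3, h4⟩ := h
  refine ⟨insert I 𝒟, ?_, ?_, ?_, ?_⟩
  · simpa using ⟨hI, h1⟩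
  · rw [Finset.coe_insert]
    refine h2.insert fun J hJ _ => hd.mono_right ?_
    rw [← h3]
    exact Finset.subset_biUnion_of_mem id hJ
  · rw [Finset.biUnion_insert, h3, id]
  · exact (Finset.card_insert_le _ _).trans (by omega)

end DisjointCover

lemma isDyadicInterval_filter {k s : ℕ} (hs : s ≤ k) {a : ℕ} (ha : a + 1 ≤ 2 ^ (k - s)) :
    IsDyadicInterval (Finset.univ.filter
      (fun i : Fin (2 ^ k) => a * 2 ^ s ≤ i.val ∧ i.val < (a + 1) * 2 ^ s)) := by
  refine ⟨s, a + 1, hs, by omega, ha, ?_⟩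
  ext i
  simp only [Finset.mem_filter, Finset.mem_univ, true_and, Nat.add_sub_cancel]
  omega

/-- Induction from fine to coarse scales: at scale `s` at most one block is split off at each end,
after which both endpoints are multiples of `2^(s+1)`. This costs two blocks per level and one at
the top level. Coordinates are zero-based and intervals half-open. -/
lemma hasDisjointCover_dyadic {k : ℕ} (j s : ℕ) (hs : s + j = k) (a b : ℕ) (hab : a ≤ b)
    (hb : b ≤ 2 ^ j) :
    HasDisjointCover IsDyadicInterval (Finset.univ.filter
      (fun i : Fin (2 ^ k) => a * 2 ^ s ≤ i.val ∧ i.val < b * 2 ^ s)) (2 * j + 1) := by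
  induction j generalizing s a b with
  | zero =>
    rcases hab.eq_or_lt with rfl | hlt
    · refine (HasDisjointCover.empty _ 0).mono (Finset.filter_eq_empty_iff.2 ?_).symm (by omega)
      intro i _
      omega
    · have hb' : b = a + 1 := by simp at hb; omega
      subst hb'
      have h := (HasDisjointCover.empty IsDyadicInterval 0).union
        (isDyadicInterval_filter (k := k) (s := s) (a := a) (by omega)
          (by rw [← hs]; simpa using hb)) (Finset.disjoint_empty_right _)
      simpa using h
  | succ j ih =>
    rcases hab.eq_or_lt with rfl | hlt
    · refine (HasDisjointCover.empty _ 0).mono (Finset.filter_eq_empty_iff.2 ?_).symm (by omega)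
      intro i _
      omega
    rw [pow_succ] at hb
    have hks : k - s = j + 1 := by omega
    -- The left endpoint is rounded up and the right one down; `a < b` keeps them in order. An odd
    -- `a` or an odd `b` then costs one extra block of scale `s`.
    have h0 := ih (s + 1) (by omega) ((a + 1) / 2) (b / 2) (by omega) (by omega)
    have h1 : HasDisjointCover IsDyadicInterval (Finset.univ.filter
        (fun i : Fin (2 ^ k) => a * 2 ^ s ≤ i.val ∧ i.val < b / 2 * 2 ^ (s + 1)))
        (2 * j + 2) := by
      rcases Nat.even_or_odd' a with ⟨m, rfl | rfl⟩
      · have e : (2 * m + 1) / 2 = m := by omega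
        rw [e] at h0
        have e2 : m * 2 ^ (s + 1) = 2 * m * 2 ^ s := by rw [pow_succ]; ring
        exact h0.mono (by rw [e2]) (Nat.le_succ _)
      · have e : (2 * m + 1 + 1) / 2 = m + 1 := by omega
        rw [e] at h0
        have e2 : (m + 1) * 2 ^ (s + 1) = (2 * m + 1 + 1) * 2 ^ s := by rw [pow_succ]; ring
        have e3 : m + 1 ≤ b / 2 := by omega
        have e4 := Nat.mul_le_mul_right (2 ^ (s + 1)) e3
        have e5 : (2 * m + 1) * 2 ^ s ≤ (2 * m + 1 + 1) * 2 ^ s := Nat.mul_le_mul_right _ (by omega)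
        refine (h0.union (isDyadicInterval_filter (k := k) (s := s) (a := 2 * m + 1) (by omega)
          (by rw [hks, pow_succ]; omega)) ?_).mono ?_ le_rfl
        swap
        · ext i
          simp only [Finset.mem_filter, Finset.mem_univ, true_and, Finset.mem_union]
          omega
        · rw [Finset.disjoint_filter]
          intro i _
          omega
    rcases Nat.even_or_odd' b with ⟨m, rfl | rfl⟩
    · have e : 2 * m / 2 = m := by omega
      rw [e] at h1
      have e2 : m * 2 ^ (s + 1) = 2 * m * 2 ^ s := by rw [pow_succ]; ring
      exact h1.mono (by rw [e2]) (by omega)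
    · have e : (2 * m + 1) / 2 = m := by omega
      rw [e] at h1
      have e2 : m * 2 ^ (s + 1) = 2 * m * 2 ^ s := by rw [pow_succ]; ring
      have e5 : 2 * m * 2 ^ s ≤ (2 * m + 1) * 2 ^ s := Nat.mul_le_mul_right _ (by omega)
      have e6 : a * 2 ^ s ≤ 2 * m * 2 ^ s := Nat.mul_le_mul_right _ (by omega)
      refine (h1.union (isDyadicInterval_filter (k := k) (s := s) (a := 2 * m) (by omega)
        (by rw [hks, pow_succ]; omega)) ?_).mono ?_ (by omega)
      swap
      · ext i
        simp only [Finset.mem_filter, Finset.mem_univ, true_and, Finset.mem_union]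
        omega
      · rw [Finset.disjoint_filter]
        intro i _
        omega

lemma hasDisjointCover_dyadic_Icc {k : ℕ} (a b : Fin (2 ^ k)) (hab : a ≤ b) :
    HasDisjointCover IsDyadicInterval (Finset.Icc a b) (2 * k + 1) := by
  refine (hasDisjointCover_dyadic k 0 (zero_add k) a.val (b.val + 1)
    (by have : a.val ≤ b.val := hab; omega) b.2).mono ?_ le_rfl
  ext i
  simp only [Finset.mem_Icc, Finset.mem_filter, Finset.mem_univ, true_and, Fin.le_def, pow_zero,
    mul_one]
  omega

/-- Products of the one-dimensional covers: two distinct products differ in some coordinate, and are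
already disjoint there. -/
lemma IsRectangle.hasDisjointCover {d k : ℕ} {R : Finset (Grid d (2 ^ k))} (hR : IsRectangle R) :
    HasDisjointCover IsDyadicRectangle R ((2 * k + 1) ^ d) := by
  obtain ⟨a, b, hab, rfl⟩ := hR
  choose D h1 h2 h3 h4 using fun i => hasDisjointCover_dyadic_Icc (a i) (b i) (hab i)
  refine ⟨(Fintype.piFinset D).image fun J => Fintype.piFinset J, ?_, ?_, ?_, ?_⟩
  · intro I hI
    obtain ⟨J, hJ, rfl⟩ := Finset.mem_image.1 hI
    exact ⟨J, fun i => h1 i _ (Fintype.mem_piFinset.1 hJ i), rfl⟩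
  · intro I hI I' hI' hne
    obtain ⟨J, hJ, rfl⟩ := Finset.mem_image.1 (Finset.mem_coe.1 hI)
    obtain ⟨J', hJ', rfl⟩ := Finset.mem_image.1 (Finset.mem_coe.1 hI')
    have : J ≠ J' := fun h => hne (by rw [h])
    obtain ⟨i, hi⟩ := Function.ne_iff.1 this
    simp only [Function.onFun, id]
    rw [Finset.disjoint_left]
    intro x hx hx'
    have hd := h2 i (Fintype.mem_piFinset.1 hJ i) (Fintype.mem_piFinset.1 hJ' i) hi
    exact Finset.disjoint_left.1 hd (Fintype.mem_piFinset.1 hx i) (Fintype.mem_piFinset.1 hx' i)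
  · ext x
    simp only [Finset.mem_biUnion, Finset.mem_image, id, Fintype.mem_piFinset]
    simp only [← h3, Finset.mem_biUnion, id]
    constructor
    · rintro ⟨_, ⟨J, hJ, rfl⟩, hx⟩ i
      exact ⟨J i, hJ i, Fintype.mem_piFinset.1 hx i⟩
    · intro h
      choose J hJ hx using h
      exact ⟨_, ⟨J, hJ, rfl⟩, Fintype.mem_piFinset.2 hx⟩
  · refine Finset.card_image_le.trans ?_
    rw [Fintype.card_piFinset]
    refine (Finset.prod_le_prod' fun i _ => h4 i).trans ?_
    simp

/-- There are at most `2^(k-s)` dyadic intervals of length `2^s`, and the geometric sum over `s` is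
below `2 * 2^k`. -/
lemma card_dyadicRectangles_le (d k : ℕ) :
    (dyadicRectangles d k).card ≤ (2 * 2 ^ k) ^ d := by
  classical
  set D : Finset (Finset (Fin (2 ^ k))) := (Finset.range (k + 1)).biUnion fun s =>
    (Finset.Icc 1 (2 ^ (k - s))).image fun a => Finset.univ.filter
      (fun i : Fin (2 ^ k) => (a - 1) * 2 ^ s < i.val + 1 ∧ i.val + 1 ≤ a * 2 ^ s) with hD
  have hsub : dyadicRectangles d k
      ⊆ (Fintype.piFinset fun _ : Fin d => D).image fun J => Fintype.piFinset J := by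
    intro R hR
    obtain ⟨J, hJ, rfl⟩ := (Finset.mem_filter.1 hR).2
    refine Finset.mem_image.2 ⟨J, Fintype.mem_piFinset.2 fun i => ?_, rfl⟩
    obtain ⟨s, a, h1, h2, h3, h4⟩ := hJ i
    exact Finset.mem_biUnion.2 ⟨s, Finset.mem_range.2 (by omega),
      Finset.mem_image.2 ⟨a, Finset.mem_Icc.2 ⟨h2, h3⟩, h4.symm⟩⟩
  have hDc : D.card ≤ 2 * 2 ^ k := by
    calc D.card ≤ ∑ s ∈ Finset.range (k + 1), 2 ^ (k - s) := by
          refine Finset.card_biUnion_le.trans (Finset.sum_le_sum fun s _ => ?_)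
          refine Finset.card_image_le.trans ?_
          simp
      _ = ∑ s ∈ Finset.range (k + 1), 2 ^ s := by
          rw [← Finset.sum_range_reflect]
          refine Finset.sum_congr rfl fun s hs => ?_
          rw [Finset.mem_range] at hs
          congr 1
          omega
      _ ≤ 2 * 2 ^ k := by
          rw [Nat.geomSum_eq le_rfl, pow_succ]
          simp
          omega
  calc (dyadicRectangles d k).card ≤ (Fintype.piFinset fun _ : Fin d => D).card :=
        (Finset.card_le_card hsub).trans Finset.card_image_le
    _ = D.card ^ d := by simp
    _ ≤ _ := Nat.pow_le_pow_left hDc d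

/-! ### Consequences of the sub-Gaussian tails. -/

section Tails

variable {Ω : Type*} [MeasurableSpace Ω] {μ : Measure Ω} [IsProbabilityMeasure μ]

/-- Layer-cake formula with `(M + t)² ≥ M² + t²`: the Gaussian integral leaves the factor `2√(2π)`,
which is at most 6. -/
lemma integrable_excess_and_integral_le {X : Ω → ℝ} (hX : Measurable X)
    (htail : ∀ x : ℝ, 0 ≤ x → μ.real {ω | x ≤ |X ω|} ≤ 4 * Real.exp (-x ^ 2 / 2))
    {M : ℝ} (hM : 0 ≤ M) :
    Integrable (fun ω => max (|X ω| - M) 0) μ ∧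
      ∫ ω, max (|X ω| - M) 0 ∂μ ≤ 6 * Real.exp (-M ^ 2 / 2) := by
  set f : Ω → ℝ := fun ω => max (|X ω| - M) 0 with hf
  have hfm : Measurable f := by fun_prop
  have hf0 : 0 ≤ᵐ[μ] f := ae_of_all _ fun ω => le_max_right _ _
  have hgi : Integrable (fun t : ℝ => 4 * Real.exp (-M ^ 2 / 2) * Real.exp (-(1 / 2) * t ^ 2))
      (volume.restrict (Set.Ioi 0)) :=
    ((integrable_exp_neg_mul_sq (by norm_num)).const_mul _).integrableOn
  have hbound : ∫⁻ ω, ENNReal.ofReal (f ω) ∂μ ≤ ENNReal.ofReal (6 * Real.exp (-M ^ 2 / 2)) := by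
    calc ∫⁻ ω, ENNReal.ofReal (f ω) ∂μ = ∫⁻ t in Set.Ioi 0, μ {ω | t ≤ f ω} :=
          lintegral_eq_lintegral_meas_le μ hf0 hfm.aemeasurable
      _ ≤ ∫⁻ t in Set.Ioi (0 : ℝ), ENNReal.ofReal
            (4 * Real.exp (-M ^ 2 / 2) * Real.exp (-(1 / 2) * t ^ 2)) := by
          refine setLIntegral_mono' measurableSet_Ioi fun t ht => ?_
          have ht0 : (0 : ℝ) < t := ht
          rw [← ofReal_measureReal]
          refine ENNReal.ofReal_le_ofReal ?_
          calc μ.real {ω | t ≤ f ω} ≤ μ.real {ω | M + t ≤ |X ω|} := by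
                refine measureReal_mono fun ω hω => ?_
                have hω : t ≤ max (|X ω| - M) 0 := hω
                rcases le_max_iff.1 hω with h | h
                · show M + t ≤ |X ω|
                  linarith
                · linarith
            _ ≤ 4 * Real.exp (-(M + t) ^ 2 / 2) := htail _ (by linarith)
            _ ≤ 4 * Real.exp (-M ^ 2 / 2) * Real.exp (-(1 / 2) * t ^ 2) := by
                rw [mul_assoc, ← Real.exp_add]
                gcongr
                nlinarith [mul_nonneg hM ht0.le]
      _ = ENNReal.ofReal (∫ t in Set.Ioi (0 : ℝ),
            4 * Real.exp (-M ^ 2 / 2) * Real.exp (-(1 / 2) * t ^ 2)) :=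
          (ofReal_integral_eq_lintegral_ofReal hgi (ae_of_all _ fun t => by positivity)).symm
      _ ≤ ENNReal.ofReal (6 * Real.exp (-M ^ 2 / 2)) := by
          refine ENNReal.ofReal_le_ofReal ?_
          rw [integral_const_mul, integral_gaussian_Ioi]
          have h1 : √(Real.pi / (1 / 2)) ≤ 3 := by
            rw [Real.sqrt_le_left (by norm_num)]
            linarith [Real.pi_lt_four]
          nlinarith [Real.exp_pos (-M ^ 2 / 2)]
  refine ⟨⟨hfm.aestronglyMeasurable, ?_⟩, ?_⟩
  · rw [hasFiniteIntegral_iff_ofReal hf0]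
    exact hbound.trans_lt ENNReal.ofReal_lt_top
  · rw [integral_eq_lintegral_of_nonneg_ae hf0 hfm.aestronglyMeasurable]
    exact ENNReal.toReal_le_of_le_ofReal (by positivity) hbound

/-- Since `θ + σX` has mean `θ`, the bias is the mean truncation error. As `|θ| + σM ≤ lam`, that
error is at most `σ` times the excess of `|X|` over `M`. -/
lemma abs_integral_truncate_sub_le {X : Ω → ℝ} (hX : Measurable X)
    (htail : ∀ x : ℝ, 0 ≤ x → μ.real {ω | x ≤ |X ω|} ≤ 4 * Real.exp (-x ^ 2 / 2))
    (hmean : ∫ ω, X ω ∂μ = 0) {σ M lam θ : ℝ} (hσ : 0 < σ) (hM : 0 ≤ M) (hlam : 0 ≤ lam)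
    (hθ : |θ| + σ * M ≤ lam) :
    |∫ ω, (truncate lam (θ + σ * X ω) - θ) ∂μ| ≤ 6 * σ * Real.exp (-M ^ 2 / 2) := by
  obtain ⟨hi, hle⟩ := integrable_excess_and_integral_le hX htail hM
  have hXi : Integrable X μ := by
    have h := (integrable_excess_and_integral_le hX htail le_rfl).1
    refine h.mono' hX.aestronglyMeasurable (ae_of_all _ fun ω => ?_)
    rw [sub_zero]
    exact le_max_left _ _
  have hpt : ∀ ω, |truncate lam (θ + σ * X ω) - (θ + σ * X ω)| ≤ σ * max (|X ω| - M) 0 := by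
    intro ω
    refine (abs_truncate_sub_self_le hlam _).trans (max_le ?_ (by positivity))
    have h1 := abs_add_le θ (σ * X ω)
    rw [abs_mul, abs_of_pos hσ] at h1
    have h2 := mul_le_mul_of_nonneg_left (le_max_left (|X ω| - M) 0) hσ.le
    linarith
  have hdi : Integrable (fun ω => truncate lam (θ + σ * X ω) - (θ + σ * X ω)) μ := by
    refine (hi.const_mul σ).mono' ?_ (ae_of_all _ hpt)
    have := (measurable_truncate lam).comp ((hX.const_mul σ).const_add θ)
    exact (this.sub ((hX.const_mul σ).const_add θ)).aestronglyMeasurable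
  have e : ∫ ω, (truncate lam (θ + σ * X ω) - θ) ∂μ
      = ∫ ω, (truncate lam (θ + σ * X ω) - (θ + σ * X ω)) ∂μ := by
    have : (fun ω => truncate lam (θ + σ * X ω) - θ)
        = fun ω => (truncate lam (θ + σ * X ω) - (θ + σ * X ω)) + σ * X ω := by
      ext ω; ring
    rw [this, integral_add hdi (hXi.const_mul σ), integral_const_mul, hmean, mul_zero, add_zero]
  rw [e, ← Real.norm_eq_abs]
  refine (norm_integral_le_integral_norm _).trans ?_
  refine (integral_mono hdi.norm (hi.const_mul σ) hpt).trans ?_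
  rw [integral_const_mul]
  nlinarith

lemma measureReal_exists_lt_abs_le {K : Type*} [Fintype K] {X : K → Ω → ℝ}
    (htail : ∀ s, ∀ x : ℝ, 0 ≤ x → μ.real {ω | x ≤ |X s ω|} ≤ 4 * Real.exp (-x ^ 2 / 2))
    {σ M lam : ℝ} {θ : K → ℝ} (hσ : 0 < σ) (hM : 0 ≤ M) (hθ : ∀ s, |θ s| + σ * M ≤ lam) :
    μ.real {ω | ∃ s, lam < |θ s + σ * X s ω|}
      ≤ Fintype.card K * (4 * Real.exp (-M ^ 2 / 2)) := by
  have hsub : {ω | ∃ s, lam < |θ s + σ * X s ω|} ⊆ ⋃ s ∈ Finset.univ, {ω | M ≤ |X s ω|} := by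
    rintro ω ⟨s, hs⟩
    refine Set.mem_biUnion (Finset.mem_coe.2 (Finset.mem_univ s)) ?_
    have h1 := abs_add_le (θ s) (σ * X s ω)
    rw [abs_mul, abs_of_pos hσ] at h1
    have h2 := hθ s
    exact le_of_mul_le_mul_left (by linarith) hσ
  refine (measureReal_mono hsub (measure_ne_top _ _)).trans ((measureReal_biUnion_finset_le _ _).trans ?_)
  refine (Finset.sum_le_card_nsmul _ _ _ fun s _ => htail s M hM).trans ?_
  rw [nsmul_eq_mul, Finset.card_univ]

end Tails

/-! ### Predictions as functions of the history, and the non-anticipating property. -/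

section Measurability

lemma measurable_history {Ω K : Type*} [MeasurableSpace Ω] [Fintype K] [MeasurableSpace K]
    [MeasurableSingletonClass K] {N : ℕ} {y : Ω → K → ℝ} (hy : ∀ s, Measurable fun ω => y ω s)
    {ρ : Ω → (Fin N ≃ K)} (hρ : ∀ t, Measurable fun ω => ρ ω t) (t : Fin N) :
    Measurable (history y ρ t) := by
  have hy' : Measurable fun x : Ω × K => y x.1 x.2 := measurable_from_prod_countable_left hy
  refine Measurable.prodMk (f := fun ω (i : {i : Fin N // i ≤ t}) => ρ ω i)
    (g := fun ω (i : {i : Fin N // i < t}) => y ω (ρ ω i))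
    (measurable_pi_lambda _ fun i => hρ i) (measurable_pi_lambda _ fun i => ?_)
  exact hy'.comp (measurable_id.prodMk (hρ i))

/-- On `{ρ t = s}` the joint law of the history and `ε s` is a product measure: `condLaw` says so on
measurable rectangles, and these determine it. Fubini then splits the integral. -/
lemma IsNonAnticipating.setIntegral_mul {Ω K : Type*} [MeasurableSpace Ω] [Fintype K]
    [MeasurableSpace K] [MeasurableSingletonClass K] {N : ℕ} {μ : Measure Ω} [IsProbabilityMeasure μ]
    {ε : K → Ω → ℝ} {y : Ω → K → ℝ} {ρ : Ω → (Fin N ≃ K)}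
    (h : IsNonAnticipating μ ε y ρ) (hε : ∀ s, Measurable (ε s))
    (hy : ∀ s, Measurable fun ω => y ω s) (t : Fin N) (s : K)
    {F : ({i : Fin N // i ≤ t} → K) × ({i : Fin N // i < t} → ℝ) → ℝ} (hF : Measurable F)
    {g : ℝ → ℝ} (hg : Measurable g) :
    ∫ ω in {ω | ρ ω t = s}, F (history y ρ t ω) * g (ε s ω) ∂μ
      = (∫ ω in {ω | ρ ω t = s}, F (history y ρ t ω) ∂μ) * ∫ ω, g (ε s ω) ∂μ := by
  have hE : MeasurableSet {ω | ρ ω t = s} := h.measurable t (measurableSet_singleton s)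
  have hH := measurable_history hy h.measurable t
  have hprod : ((μ.restrict {ω | ρ ω t = s}).map (history y ρ t)).prod (μ.map (ε s))
      = (μ.restrict {ω | ρ ω t = s}).map (fun ω => (history y ρ t ω, ε s ω)) := by
    have := Measure.isProbabilityMeasure_map (μ := μ) (hε s).aemeasurable
    refine Measure.prod_eq fun A B hA hB => ?_
    rw [Measure.map_apply (hH.prodMk (hε s)) (hA.prod hB), Measure.map_apply hH hA,
      Measure.map_apply (hε s) hB,
      Measure.restrict_apply ((hH.prodMk (hε s)) (hA.prod hB)), Measure.restrict_apply (hH hA)]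
    refine (congrArg μ (Set.ext fun ω => ?_)).trans (h.condLaw t s A B hA hB)
    show ((history y ρ t ω ∈ A ∧ ε s ω ∈ B) ∧ ρ ω t = s)
      ↔ (history y ρ t ω ∈ A ∧ ρ ω t = s ∧ ε (ρ ω t) ω ∈ B)
    constructor
    · rintro ⟨⟨h1, h2⟩, h3⟩
      exact ⟨h1, h3, by rwa [h3]⟩
    · rintro ⟨h1, h3, h2⟩
      exact ⟨⟨h1, by rwa [h3] at h2⟩, h3⟩
  have hFG : Measurable fun z : (({i : Fin N // i ≤ t} → K) × ({i : Fin N // i < t} → ℝ)) × ℝ =>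
      F z.1 * g z.2 := (hF.comp measurable_fst).mul (hg.comp measurable_snd)
  have h1 := integral_prod_mul (μ := (μ.restrict {ω | ρ ω t = s}).map (history y ρ t))
    (ν := μ.map (ε s)) F g
  rw [hprod, integral_map (hH.prodMk (hε s)).aemeasurable hFG.aestronglyMeasurable,
    integral_map hH.aemeasurable hF.aestronglyMeasurable,
    integral_map (hε s).aemeasurable hg.aestronglyMeasurable] at h1
  exact h1

variable {K : Type*} [DecidableEq K] {N : ℕ}

lemma revealedIn_congr {ρ ρ' : Fin N ≃ K} (S : Finset K) {j : ℕ}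
    (h : ∀ i : Fin N, i.val < j → ρ i = ρ' i) : revealedIn ρ S j = revealedIn ρ' S j := by
  unfold revealedIn
  rw [Finset.image_congr fun i hi => h i (by simpa using hi)]

lemma expertPrediction_meanRule_congr {ρ ρ' : Fin N ≃ K} {y y' : K → ℝ} {t : Fin N}
    (hρ : ∀ i < t, ρ i = ρ' i) (hy : ∀ i < t, y (ρ i) = y' (ρ i)) (S : Finset K) :
    expertPrediction (meanRule K) ρ y S t = expertPrediction (meanRule K) ρ' y' S t := by
  rw [expertPrediction_meanRule, expertPrediction_meanRule, revealed_inter_eq, revealed_inter_eq,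
    ← revealedIn_congr S hρ]
  congr 1
  refine Finset.sum_congr rfl fun s hs => ?_
  rw [mem_revealedIn] at hs
  simpa using hy (ρ.symm s) hs.1

lemma activeExperts_congr {ρ ρ' : Fin N ≃ K} {t : Fin N} (hρ : ∀ i ≤ t, ρ i = ρ' i)
    (𝒮 : Finset (Finset K)) : activeExperts 𝒮 ρ t = activeExperts 𝒮 ρ' t := by
  unfold activeExperts
  refine Finset.filter_congr fun S _ => ?_
  rw [hρ t le_rfl]
  refine and_congr_right fun _ => or_congr_right (exists_congr fun i => ?_)
  exact and_congr_right fun hi => by rw [hρ i hi.le]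

lemma expertWeight_meanRule_congr {ρ ρ' : Fin N ≃ K} {y y' : K → ℝ} (𝒮 : Finset (Finset K))
    (lam : ℝ) {j : ℕ} (hρ : ∀ i : Fin N, i.val < j → ρ i = ρ' i)
    (hy : ∀ i : Fin N, i.val < j → y (ρ i) = y' (ρ i)) (S : Finset K) :
    expertWeight (meanRule K) 𝒮 lam ρ y j S = expertWeight (meanRule K) 𝒮 lam ρ' y' j S := by
  induction j generalizing S with
  | zero => rfl
  | succ j ih =>
    have ih := ih (fun i hi => hρ i (by omega)) (fun i hi => hy i (by omega))
    rw [expertWeight, expertWeight]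
    by_cases h : j < N
    · have hA := activeExperts_congr (ρ := ρ) (ρ' := ρ') (t := ⟨j, h⟩)
        (fun i hi => hρ i (Nat.lt_succ_of_le hi)) 𝒮
      have hl : ∀ S, expertLoss (meanRule K) lam ρ y S ⟨j, h⟩
          = expertLoss (meanRule K) lam ρ' y' S ⟨j, h⟩ := fun S => by
        rw [expertLoss, expertLoss, hy ⟨j, h⟩ (Nat.lt_succ_self j),
          expertPrediction_meanRule_congr (ρ' := ρ') (y' := y')
            (fun i hi => hρ i (Nat.lt_succ_of_lt hi)) (fun i hi => hy i (Nat.lt_succ_of_lt hi)),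
          hρ ⟨j, h⟩ (Nat.lt_succ_self j)]
      simp only [dif_pos h, hA, hl, ih]
    · simp only [dif_neg h, ih]

/-- A prediction depends only on the data available when it is made. -/
lemma aggregatePrediction_meanRule_congr {ρ ρ' : Fin N ≃ K} {y y' : K → ℝ}
    (𝒮 : Finset (Finset K)) (lam : ℝ) {t : Fin N} (hρ : ∀ i ≤ t, ρ i = ρ' i)
    (hy : ∀ i < t, y (ρ i) = y' (ρ i)) :
    aggregatePrediction (meanRule K) 𝒮 lam ρ y t
      = aggregatePrediction (meanRule K) 𝒮 lam ρ' y' t := by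
  have h1 := activeExperts_congr hρ 𝒮
  have h2 := fun S => expertPrediction_meanRule_congr (fun i hi => hρ i (le_of_lt hi)) hy S
  have h3 := fun S => expertWeight_meanRule_congr (j := t) 𝒮 lam
    (fun i hi => hρ i (le_of_lt hi)) hy S
  simp only [aggregatePrediction, h1, h2, h3]

lemma measurable_expertPrediction_meanRule (ρ : Fin N ≃ K) (S : Finset K) (t : Fin N) :
    Measurable fun y : K → ℝ => expertPrediction (meanRule K) ρ y S t := by
  simp only [expertPrediction_meanRule]
  fun_prop

lemma measurable_expertLoss_meanRule (lam : ℝ) (ρ : Fin N ≃ K) (S : Finset K) (t : Fin N) :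
    Measurable fun y : K → ℝ => expertLoss (meanRule K) lam ρ y S t :=
  (((measurable_truncate lam).comp (measurable_pi_apply (ρ t))).sub
    ((measurable_truncate lam).comp (measurable_expertPrediction_meanRule ρ S t))).pow_const 2

lemma measurable_expertWeight_meanRule (𝒮 : Finset (Finset K)) (lam : ℝ) (ρ : Fin N ≃ K) (j : ℕ)
    (S : Finset K) : Measurable fun y : K → ℝ => expertWeight (meanRule K) 𝒮 lam ρ y j S := by
  induction j generalizing S with
  | zero => exact measurable_const
  | succ j ih =>
    simp only [expertWeight]
    split_ifs with h hS
    · have hm := fun S => (ih S).mul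
        ((measurable_expertLoss_meanRule lam ρ S ⟨j, h⟩).const_mul (-(1 / (8 * lam ^ 2)))).exp
      exact ((hm S).div (Finset.measurable_fun_sum _ fun S' _ => hm S')).mul
        (Finset.measurable_fun_sum _ fun S' _ => ih S')
    · exact ih S
    · exact ih S

lemma measurable_aggregatePrediction_meanRule (𝒮 : Finset (Finset K)) (lam : ℝ) (ρ : Fin N ≃ K)
    (t : Fin N) : Measurable fun y : K → ℝ => aggregatePrediction (meanRule K) 𝒮 lam ρ y t := by
  unfold aggregatePrediction
  refine Finset.measurable_fun_sum _ fun S _ => ?_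
  have hw := fun S => measurable_expertWeight_meanRule 𝒮 lam ρ t.val S
  exact ((hw S).div (Finset.measurable_fun_sum _ fun S' _ => hw S')).mul
    ((measurable_truncate lam).comp (measurable_expertPrediction_meanRule ρ S t))

/-- The round in which `s` is revealed is random; splitting over its value allows conditioning on
the history of a fixed round. -/
lemma aggregate_eq_sum_indicator {Ω : Type*} (𝒮 : Finset (Finset K)) (lam : ℝ) (ρ : Ω → (Fin N ≃ K))
    (y : Ω → K → ℝ) (s : K) (ω : Ω) (f : ℝ → ℝ) :
    f (aggregate (meanRule K) 𝒮 lam (ρ ω) (y ω) s)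
      = ∑ t, {ω | ρ ω t = s}.indicator
        (fun ω => f (aggregatePrediction (meanRule K) 𝒮 lam (ρ ω) (y ω) t)) ω := by
  rw [Finset.sum_eq_single ((ρ ω).symm s)]
  · rw [Set.indicator_of_mem (by simp)]
    rfl
  · intro t _ ht
    refine Set.indicator_of_notMem (fun h => ht ?_) _
    rw [eq_comm, Equiv.symm_apply_eq]
    exact (show ρ ω t = s from h).symm
  · simp

variable [Fintype K] [MeasurableSpace K] [MeasurableSingletonClass K]

/-- A prediction is a bounded measurable function of the history. -/
lemma exists_measurable_aggregatePrediction_eq (𝒮 : Finset (Finset K)) {lam : ℝ} (hlam : 0 ≤ lam)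
    (t : Fin N) :
    ∃ F : ({i : Fin N // i ≤ t} → K) × ({i : Fin N // i < t} → ℝ) → ℝ, Measurable F ∧
      (∀ x, |F x| ≤ lam) ∧ ∀ (ρ : Fin N ≃ K) (y : K → ℝ),
        aggregatePrediction (meanRule K) 𝒮 lam ρ y t = F (fun i => ρ i, fun i => y (ρ i)) := by
  classical
  let ext : ({i : Fin N // i < t} → ℝ) → (Fin N ≃ K) → K → ℝ := fun v π s =>
    if h : π.symm s < t then v ⟨π.symm s, h⟩ else 0
  -- Any enumeration that extends the observed prefix may be chosen, with unseen data set to zero: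
  -- the prediction does not depend on the continuation. Prefixes take values in a finite set, so
  -- measurability is only needed in the data.
  let F : ({i : Fin N // i ≤ t} → K) × ({i : Fin N // i < t} → ℝ) → ℝ := fun x =>
    if h : ∃ π : Fin N ≃ K, ∀ i : {i : Fin N // i ≤ t}, π i = x.1 i then
      aggregatePrediction (meanRule K) 𝒮 lam h.choose (ext x.2 h.choose) t else 0
  refine ⟨F, ?_, ?_, ?_⟩
  · refine measurable_from_prod_countable_right fun a => ?_
    by_cases h : ∃ π : Fin N ≃ K, ∀ i : {i : Fin N // i ≤ t}, π i = a i
    · simp only [F, dif_pos h]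
      refine (measurable_aggregatePrediction_meanRule 𝒮 lam h.choose t).comp ?_
      refine measurable_pi_lambda _ fun s => ?_
      simp only [ext]
      split_ifs with hs
      · exact measurable_pi_apply _
      · exact measurable_const
    · simp only [F, dif_neg h]
      exact measurable_const
  · intro x
    simp only [F]
    split_ifs with h
    · exact abs_aggregatePrediction_le _ _ _ hlam t
    · simpa using hlam
  · intro ρ y
    have h : ∃ π : Fin N ≃ K, ∀ i : {i : Fin N // i ≤ t}, π i = ρ i := ⟨ρ, fun _ => rfl⟩
    simp only [F, dif_pos h]
    have hπ := h.choose_spec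
    refine aggregatePrediction_meanRule_congr 𝒮 lam (fun i hi => (hπ ⟨i, hi⟩).symm) ?_
    intro i hi
    have e : h.choose.symm (ρ i) = i := by
      rw [Equiv.symm_apply_eq]
      exact (hπ ⟨i, hi.le⟩).symm
    simp only [ext, e, dif_pos hi]

variable {Ω : Type*} [MeasurableSpace Ω] {μ : Measure Ω}

lemma measurable_aggregate_meanRule (𝒮 : Finset (Finset K)) {lam : ℝ} (hlam : 0 ≤ lam)
    {y : Ω → K → ℝ} (hy : ∀ s, Measurable fun ω => y ω s)
    {ρ : Ω → (Fin N ≃ K)} (hρ : ∀ t, Measurable fun ω => ρ ω t) (s : K) :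
    Measurable fun ω => aggregate (meanRule K) 𝒮 lam (ρ ω) (y ω) s := by
  have h := fun ω => aggregate_eq_sum_indicator 𝒮 lam ρ y s ω id
  simp only [id] at h
  simp only [h]
  refine Finset.measurable_fun_sum _ fun t _ => ?_
  refine Measurable.indicator ?_ (hρ t (measurableSet_singleton s))
  obtain ⟨F, hF, -, hFe⟩ := exists_measurable_aggregatePrediction_eq 𝒮 hlam t
  simp only [hFe]
  exact hF.comp (measurable_history hy hρ t)

variable [IsProbabilityMeasure μ]

/-- Under a non-anticipating order the prediction at `s` is uncorrelated with functions of the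
noise at `s`. -/
lemma IsNonAnticipating.integral_aggregate_mul {ε : K → Ω → ℝ} {y : Ω → K → ℝ}
    {ρ : Ω → (Fin N ≃ K)} (h : IsNonAnticipating μ ε y ρ) (hε : ∀ s, Measurable (ε s))
    (hy : ∀ s, Measurable fun ω => y ω s) (𝒮 : Finset (Finset K)) {lam : ℝ} (hlam : 0 ≤ lam)
    (s : K) (θ : ℝ) {g : ℝ → ℝ} (hg : Measurable g) {b : ℝ} (hgb : ∀ x, |g x| ≤ b) :
    ∫ ω, (aggregate (meanRule K) 𝒮 lam (ρ ω) (y ω) s - θ) * g (ε s ω) ∂μ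
      = (∫ ω, (aggregate (meanRule K) 𝒮 lam (ρ ω) (y ω) s - θ) ∂μ) * ∫ ω, g (ε s ω) ∂μ := by
  choose F hF hFb hFe using
    fun t : Fin N => exists_measurable_aggregatePrediction_eq (K := K) 𝒮 hlam t
  have hE : ∀ t, MeasurableSet {ω | ρ ω t = s} :=
    fun t => h.measurable t (measurableSet_singleton s)
  have hFH : ∀ t, Measurable fun ω => F t (history y ρ t ω) - θ :=
    fun t => ((hF t).comp (measurable_history hy h.measurable t)).sub_const θ
  have hFi : ∀ t, Integrable (fun ω => F t (history y ρ t ω) - θ) μ := fun t =>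
    Integrable.of_bound (hFH t).aestronglyMeasurable (lam + |θ|) (ae_of_all _ fun ω =>
      (abs_sub _ _).trans (by linarith [hFb t (history y ρ t ω)]))
  have hGi : ∀ t, Integrable (fun ω => (F t (history y ρ t ω) - θ) * g (ε s ω)) μ := fun t =>
    (hFi t).mul_bdd (c := b) (hg.comp (hε s)).aestronglyMeasurable (ae_of_all _ fun ω => hgb _)
  have e1 : ∀ ω, aggregate (meanRule K) 𝒮 lam (ρ ω) (y ω) s - θ
      = ∑ t, {ω | ρ ω t = s}.indicator (fun ω => F t (history y ρ t ω) - θ) ω := fun ω => by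
    have := aggregate_eq_sum_indicator 𝒮 lam ρ y s ω (fun x => x - θ)
    simp only [hFe] at this
    exact this
  have e2 : ∀ ω, (aggregate (meanRule K) 𝒮 lam (ρ ω) (y ω) s - θ) * g (ε s ω)
      = ∑ t, {ω | ρ ω t = s}.indicator
        (fun ω => (F t (history y ρ t ω) - θ) * g (ε s ω)) ω := fun ω => by
    rw [e1, Finset.sum_mul]
    refine Finset.sum_congr rfl fun t _ => ?_
    by_cases hω : ω ∈ {ω | ρ ω t = s}
    · simp only [Set.indicator_of_mem hω]
    · simp only [Set.indicator_of_notMem hω, zero_mul]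
  simp only [e2]
  simp only [e1]
  rw [integral_finsetSum _ fun t _ => (hGi t).indicator (hE t),
    integral_finsetSum _ fun t _ => (hFi t).indicator (hE t), Finset.sum_mul]
  refine Finset.sum_congr rfl fun t _ => ?_
  rw [integral_indicator (hE t), integral_indicator (hE t)]
  exact h.setIntegral_mul hε hy t s ((hF t).sub_const θ) hg

end Measurability

/-! ### From regret on the data to risk for the signal. -/

section Risk

lemma abs_aggregate_sub_le {K : Type*} [DecidableEq K] {N : ℕ} (𝒮 : Finset (Finset K)) {lam : ℝ} (hlam : 0 ≤ lam) (ρ : Fin N ≃ K)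
    (y : K → ℝ) (s : K) {θ : ℝ} (hθ : |θ| ≤ lam) :
    |aggregate (meanRule K) 𝒮 lam ρ y s - θ| ≤ 2 * lam :=
  (abs_sub _ _).trans (by
    have := abs_aggregatePrediction_le (meanRule K) (𝒮 := 𝒮) ρ y hlam (ρ.symm s)
    unfold aggregate
    linarith)

variable {K : Type*} [DecidableEq K] [Fintype K] [MeasurableSpace K] [MeasurableSingletonClass K]
  {N : ℕ} {Ω : Type*} [MeasurableSpace Ω] {μ : Measure Ω} [IsProbabilityMeasure μ]

lemma integrable_aggregate_sub (𝒮 : Finset (Finset K)) {lam : ℝ} (hlam : 0 ≤ lam)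
    {y : Ω → K → ℝ} (hy : ∀ s, Measurable fun ω => y ω s)
    {ρ : Ω → (Fin N ≃ K)} (hρ : ∀ t, Measurable fun ω => ρ ω t) (s : K) {θ : ℝ}
    (hθ : |θ| ≤ lam) :
    Integrable (fun ω => aggregate (meanRule K) 𝒮 lam (ρ ω) (y ω) s - θ) μ :=
  Integrable.of_bound
    ((measurable_aggregate_meanRule 𝒮 hlam hy hρ s).sub_const θ).aestronglyMeasurable
    (2 * lam) (ae_of_all _ fun _ => abs_aggregate_sub_le 𝒮 hlam _ _ s hθ)

lemma integrable_aggregate_sub_sq (𝒮 : Finset (Finset K)) {lam : ℝ} (hlam : 0 ≤ lam)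
    {y : Ω → K → ℝ} (hy : ∀ s, Measurable fun ω => y ω s)
    {ρ : Ω → (Fin N ≃ K)} (hρ : ∀ t, Measurable fun ω => ρ ω t) (s : K) {θ : ℝ}
    (hθ : |θ| ≤ lam) :
    Integrable (fun ω => (aggregate (meanRule K) 𝒮 lam (ρ ω) (y ω) s - θ) ^ 2) μ := by
  have h := integrable_aggregate_sub (μ := μ) 𝒮 hlam hy hρ s hθ
  simp only [pow_two]
  exact h.mul_bdd (c := 2 * lam) h.aestronglyMeasurable
    (ae_of_all _ fun _ => abs_aggregate_sub_le 𝒮 hlam _ _ s hθ)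

/-- Risk bound for the aggregated online means on a single expert set. -/
lemma integral_sum_aggregate_sub_sq_le {𝒮 : Finset (Finset K)} {lam σ M : ℝ} {θ : K → ℝ}
    {ε : K → Ω → ℝ} {y : Ω → K → ℝ} {ρ : Ω → (Fin N ≃ K)} (hN : Fintype.card K = N)
    (hlam : 0 < lam) (hσ : 0 < σ) (hσlam : σ ≤ lam) (hM : 0 ≤ M)
    (hMN : (N : ℝ) ^ 2 * Real.exp (-M ^ 2 / 2) ≤ 1) (hθ : ∀ s, |θ s| + σ * M ≤ lam)
    (hε : ∀ s, Measurable (ε s)) (hmean : ∀ s, ∫ ω, ε s ω ∂μ = 0)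
    (htail : ∀ s, ∀ x : ℝ, 0 ≤ x → μ.real {ω | x ≤ |ε s ω|} ≤ 4 * Real.exp (-x ^ 2 / 2))
    (hy : ∀ ω s, y ω s = θ s + σ * ε s ω) (h : IsNonAnticipating μ ε y ρ)
    {S : Finset K} (hS : S ∈ 𝒮) {c : ℝ} (hc : |c| ≤ lam) :
    ∫ ω, ∑ s ∈ S, (aggregate (meanRule K) 𝒮 lam (ρ ω) (y ω) s - θ s) ^ 2 ∂μ
      ≤ ∑ s ∈ S, (θ s - c) ^ 2 + lam ^ 2 * (8 * Real.log 𝒮.card + 4 * Real.log N + 76) := by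
  set a : Ω → K → ℝ := fun ω s => aggregate (meanRule K) 𝒮 lam (ρ ω) (y ω) s with ha
  set g : K → ℝ → ℝ := fun s x => truncate lam (θ s + σ * x) - θ s with hg
  set κ : ℝ := lam ^ 2 * (8 * Real.log 𝒮.card + 4 * Real.log N + 12) with hκ
  set E : ℝ := Real.exp (-M ^ 2 / 2) with hE
  have hE0 : 0 < E := Real.exp_pos _
  have hym : ∀ s, Measurable fun ω => y ω s := fun s => by
    simp only [hy]
    exact ((hε s).const_mul σ).const_add _
  have hθ' : ∀ s, |θ s| ≤ lam := fun s => le_trans (by nlinarith) (hθ s)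
  have hgm : ∀ s, Measurable (g s) := fun s =>
    ((measurable_truncate lam).comp ((measurable_id.const_mul σ).const_add _)).sub_const _
  have hgb : ∀ s x, |g s x| ≤ 2 * lam := fun s x =>
    (abs_sub _ _).trans (by linarith [abs_truncate_le hlam.le (θ s + σ * x), hθ' s])
  have hgi : ∀ s, Integrable (fun ω => g s (ε s ω)) μ := fun s =>
    Integrable.of_bound ((hgm s).comp (hε s)).aestronglyMeasurable _ (ae_of_all _ fun ω => hgb s _)
  have hai : ∀ s, Integrable (fun ω => a ω s - θ s) μ := fun s =>
    integrable_aggregate_sub 𝒮 hlam.le hym h.measurable s (hθ' s)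
  have hagi : ∀ s, Integrable (fun ω => (a ω s - θ s) * g s (ε s ω)) μ := fun s =>
    (hai s).mul_bdd (hgi s).aestronglyMeasurable (ae_of_all _ fun ω => hgb s _)
  have hSN : (S.card : ℝ) ≤ N := by rw [← hN]; exact_mod_cast Finset.card_le_univ S
  set bad : Set Ω := {ω | ∃ s, lam < |θ s + σ * ε s ω|} with hbad
  have hbadm : MeasurableSet bad := by
    have : bad = ⋃ s, {ω | lam < |θ s + σ * ε s ω|} := by
      ext ω
      rw [Set.mem_iUnion]
      rfl
    rw [this]
    exact MeasurableSet.iUnion fun s =>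
      measurableSet_lt measurable_const (((hε s).const_mul σ).const_add _).abs
  have hbadp : μ.real bad ≤ N * (4 * E) := by
    rw [← hN]
    exact measureReal_exists_lt_abs_le htail hσ hM hθ
  -- With the truncated observation written as `θ s + g`, expanding both squares shows that `(a -
  -- θ)² - q` is exactly the regret on truncated data (`hid`).
  set q : K → Ω → ℝ := fun s ω => (θ s - c) ^ 2 + 2 * (θ s - c) * g s (ε s ω)
    + 2 * ((a ω s - θ s) * g s (ε s ω)) with hq
  have hqi' : ∀ s, Integrable (fun ω => (θ s - c) ^ 2 + 2 * (θ s - c) * g s (ε s ω)) μ :=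
    fun s => (integrable_const _).add ((hgi s).const_mul _)
  have hqi : ∀ s, Integrable (q s) μ := fun s => (hqi' s).add ((hagi s).const_mul 2)
  have hid : ∀ s ω, (a ω s - θ s) ^ 2 - q s ω
      = (truncate lam (y ω s) - a ω s) ^ 2 - (truncate lam (y ω s) - c) ^ 2 := fun s ω => by
    simp only [hq, hg, hy]
    ring
  -- Off `bad` truncation leaves the data unchanged and the deterministic regret bound applies; on
  -- `bad` each summand is at most `4 lam²`.
  have hpt : ∀ ω, ∑ s ∈ S, (a ω s - θ s) ^ 2
      ≤ ∑ s ∈ S, q s ω + κ + bad.indicator (fun _ => 4 * lam ^ 2 * N) ω := by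
    intro ω
    have hκ0 : 0 ≤ κ := by
      have h1 := Real.log_natCast_nonneg 𝒮.card
      have h2 := Real.log_natCast_nonneg N
      positivity
    suffices hs : ∑ s ∈ S, ((a ω s - θ s) ^ 2 - q s ω)
        ≤ κ + bad.indicator (fun _ => 4 * lam ^ 2 * N) ω by
      rw [Finset.sum_sub_distrib] at hs
      linarith
    simp only [hid]
    by_cases hω : ω ∈ bad
    · rw [Set.indicator_of_mem hω]
      have : ∑ s ∈ S, ((truncate lam (y ω s) - a ω s) ^ 2 - (truncate lam (y ω s) - c) ^ 2)
          ≤ S.card • (4 * lam ^ 2) := by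
        refine Finset.sum_le_card_nsmul _ _ _ fun s _ => ?_
        have h1 := abs_aggregate_sub_le 𝒮 hlam.le (ρ ω) (y ω) s (abs_truncate_le hlam.le (y ω s))
        rw [abs_sub_comm] at h1
        have h2 := sq_le_sq' (abs_le.1 h1).1 (abs_le.1 h1).2
        have h3 := sq_nonneg (truncate lam (y ω s) - c)
        simp only [ha]
        linarith
      rw [nsmul_eq_mul] at this
      nlinarith [sq_nonneg lam]
    · rw [Set.indicator_of_notMem hω, add_zero, Finset.sum_sub_distrib]
      have hyb : ∀ s, |y ω s| ≤ lam := fun s => by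
        rw [hy]
        exact not_lt.1 fun hlt => hω ⟨s, hlt⟩
      simp only [truncate_eq_self (hyb _)]
      linarith [sum_sq_sub_aggregate_le (ρ ω) (y ω) hlam hyb hS c]
  have hqS : Integrable (fun ω => ∑ s ∈ S, q s ω) μ := integrable_finsetSum _ fun s _ => hqi s
  have hqS' : Integrable (fun ω => ∑ s ∈ S, q s ω + κ) μ := hqS.add (integrable_const _)
  have hind : Integrable (bad.indicator (fun _ => 4 * lam ^ 2 * (N : ℝ))) μ :=
    (integrable_const _).indicator hbadm
  have hqint : ∀ s, ∫ ω, q s ω ∂μ ≤ (θ s - c) ^ 2 + 48 * lam ^ 2 * (N * E) := by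
    intro s
    have hβ := abs_integral_truncate_sub_le (hε s) (htail s) (hmean s) hσ hM hlam.le (hθ s)
    have hα : |∫ ω, (a ω s - θ s) ∂μ| ≤ 2 * lam := by
      have := norm_integral_le_of_norm_le_const (μ := μ) (f := fun ω => a ω s - θ s) (C := 2 * lam)
        (ae_of_all _ fun ω => abs_aggregate_sub_le 𝒮 hlam.le (ρ ω) (y ω) s (hθ' s))
      simpa using this
    have e : ∫ ω, q s ω ∂μ = (θ s - c) ^ 2 + 2 * (θ s - c) * ∫ ω, g s (ε s ω) ∂μ
        + 2 * ((∫ ω, (a ω s - θ s) ∂μ) * ∫ ω, g s (ε s ω) ∂μ) := by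
      rw [← h.integral_aggregate_mul hε hym 𝒮 hlam.le s (θ s) (hgm s) (hgb s)]
      simp only [hq]
      rw [integral_add (hqi' s) ((hagi s).const_mul 2),
        integral_add (integrable_const _) ((hgi s).const_mul _), integral_const_mul,
        integral_const_mul]
      simp [ha]
    rw [e]
    have hN1 : (1 : ℝ) ≤ N := by
      rw [← hN]
      exact_mod_cast Fintype.card_pos_iff.2 ⟨s⟩
    have hθc : |θ s - c| ≤ 2 * lam := (abs_sub _ _).trans (by linarith [hθ' s])
    have h1 : (θ s - c) * ∫ ω, g s (ε s ω) ∂μ ≤ 2 * lam * (6 * σ * E) := by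
      refine (le_abs_self _).trans ?_
      rw [abs_mul]
      exact mul_le_mul hθc hβ (abs_nonneg _) (by linarith)
    have h2 : (∫ ω, (a ω s - θ s) ∂μ) * ∫ ω, g s (ε s ω) ∂μ ≤ 2 * lam * (6 * σ * E) := by
      refine (le_abs_self _).trans ?_
      rw [abs_mul]
      exact mul_le_mul hα hβ (abs_nonneg _) (by linarith)
    -- The extra factor `N` is harmless: after summation over `S` the total is still controlled by
    -- `N² E ≤ 1`.
    have h3 : lam * (σ * E) ≤ lam * (lam * (N * E)) := by
      refine mul_le_mul_of_nonneg_left ?_ hlam.le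
      exact mul_le_mul hσlam (le_mul_of_one_le_left hE0.le hN1) hE0.le hlam.le
    nlinarith
  calc ∫ ω, ∑ s ∈ S, (a ω s - θ s) ^ 2 ∂μ
      ≤ ∫ ω, (∑ s ∈ S, q s ω + κ + bad.indicator (fun _ => 4 * lam ^ 2 * (N : ℝ)) ω) ∂μ := by
        refine integral_mono (integrable_finsetSum _ fun s _ => ?_)
          (hqS'.add hind) hpt
        exact integrable_aggregate_sub_sq 𝒮 hlam.le hym h.measurable s (hθ' s)
    _ = ∑ s ∈ S, ∫ ω, q s ω ∂μ + κ + μ.real bad * (4 * lam ^ 2 * N) := by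
        rw [integral_add hqS' hind,
          integral_add hqS (integrable_const _), integral_finsetSum _ fun s _ => hqi s,
          integral_indicator hbadm]
        simp
    -- Bias contributes 48 and the bad event 16, each through `N² E ≤ 1`; with the 12 inside `κ`
    -- this gives 76.
    _ ≤ (∑ s ∈ S, (θ s - c) ^ 2 + 48 * lam ^ 2) + κ + 16 * lam ^ 2 := by
        have h1 : ∑ s ∈ S, ∫ ω, q s ω ∂μ ≤ ∑ s ∈ S, (θ s - c) ^ 2 + 48 * lam ^ 2 := by
          refine (Finset.sum_le_sum fun s _ => hqint s).trans ?_
          rw [Finset.sum_add_distrib, Finset.sum_const, nsmul_eq_mul]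
          have h2 : (S.card : ℝ) * (N * E) ≤ 1 := by
            refine le_trans ?_ hMN
            rw [pow_two, mul_assoc]
            exact mul_le_mul_of_nonneg_right hSN (by positivity)
          nlinarith [sq_nonneg lam]
        have h3 : μ.real bad * (4 * lam ^ 2 * N) ≤ 16 * lam ^ 2 := by
          have h4 := mul_le_mul_of_nonneg_right hbadp (by positivity : 0 ≤ 4 * lam ^ 2 * (N : ℝ))
          nlinarith [sq_nonneg lam]
        linarith
    _ = _ := by rw [hκ]; ring

end Risk

/-! ### Assembly over partitions and the final constants. -/

/-- Before any data every mean is `0 / 0 = 0`. This settles the one-point lattice. -/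
lemma aggregatePrediction_meanRule_first {K : Type*} [DecidableEq K] {N : ℕ}
    (𝒮 : Finset (Finset K)) {lam : ℝ} (hlam : 0 ≤ lam) (ρ : Fin N ≃ K) (y : K → ℝ) {t : Fin N}
    (ht : t.val = 0) : aggregatePrediction (meanRule K) 𝒮 lam ρ y t = 0 := by
  unfold aggregatePrediction
  refine Finset.sum_eq_zero fun S _ => ?_
  have h0 : revealedIn ρ S t = ∅ := by
    ext s
    simp [mem_revealedIn, ht]
  rw [expertPrediction_meanRule, revealed_inter_eq, h0, Finset.sum_empty, zero_div,
    truncate_eq_self (by simpa using hlam), mul_zero]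

lemma measureReal_le_abs_le {Ω : Type*} [MeasurableSpace Ω] {μ : Measure Ω} [IsFiniteMeasure μ]
    {X : Ω → ℝ} {x b : ℝ} (h : max (μ.real {ω | x ≤ X ω}) (μ.real {ω | X ω ≤ -x}) ≤ b) :
    μ.real {ω | x ≤ |X ω|} ≤ 2 * b := by
  have hsub : {ω | x ≤ |X ω|} ⊆ {ω | x ≤ X ω} ∪ {ω | X ω ≤ -x} := by
    intro ω hω
    rcases le_abs.1 (show x ≤ |X ω| from hω) with h | h
    · exact Or.inl h
    · exact Or.inr (show X ω ≤ -x by linarith)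
  have h1 := (measureReal_mono (μ := μ) hsub).trans (measureReal_union_le _ _)
  linarith [(le_max_left _ _).trans h, (le_max_right _ _).trans h]

lemma mem_dyadicRectangles {d k : ℕ} {S : Finset (Grid d (2 ^ k))} :
    S ∈ dyadicRectangles d k ↔ IsDyadicRectangle S := by
  simp [dyadicRectangles]

/-- A bound on all dyadic rectangles yields one on all sets partitioned into rectangles. -/
lemma sum_le_of_dyadicRectangles {d k : ℕ} {T : Finset (Grid d (2 ^ k))} (P : Finpartition T)
    {θ : Grid d (2 ^ k) → ℝ} (hP : IsRectangularPartition P) (hθ : IsPiecewiseConstant P θ)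
    {e θ' : Grid d (2 ^ k) → ℝ} {κ : ℝ} (hκ : 0 ≤ κ)
    (h : ∀ S ∈ dyadicRectangles d k, ∀ c : ℝ, ∑ s ∈ S, e s ≤ ∑ s ∈ S, (θ' s - c) ^ 2 + κ) :
    ∑ s ∈ T, e s ≤ ∑ s ∈ T, (θ' s - θ s) ^ 2 + P.parts.card * ((2 * k + 1) ^ d * κ) := by
  have hR : ∀ R ∈ P.parts, ∑ s ∈ R, e s ≤ ∑ s ∈ R, (θ' s - θ s) ^ 2 + (2 * k + 1) ^ d * κ := by
    intro R hR
    obtain ⟨s₀, hs₀⟩ := P.nonempty_of_mem_parts hR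
    obtain ⟨𝒟, h1, h2, h3, h4⟩ := (hP R hR).hasDisjointCover
    have hsum : ∀ f : Grid d (2 ^ k) → ℝ, ∑ s ∈ R, f s = ∑ S ∈ 𝒟, ∑ s ∈ S, f s := fun f => by
      rw [← h3, Finset.sum_biUnion h2]
      rfl
    rw [hsum, hsum]
    calc ∑ S ∈ 𝒟, ∑ s ∈ S, e s ≤ ∑ S ∈ 𝒟, (∑ s ∈ S, (θ' s - θ s) ^ 2 + κ) := by
          refine Finset.sum_le_sum fun S hS => ?_
          -- All dyadic pieces of `R` are compared with the single value that `θ` takes on `R`.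
          refine (h S (mem_dyadicRectangles.2 (h1 S hS)) (θ s₀)).trans_eq ?_
          congr 1
          refine Finset.sum_congr rfl fun s hs => ?_
          have hsR : s ∈ R := by
            rw [← h3]
            exact Finset.mem_biUnion.2 ⟨S, hS, hs⟩
          rw [hθ R hR s hsR s₀ hs₀]
      _ ≤ _ := by
          rw [Finset.sum_add_distrib, Finset.sum_const, nsmul_eq_mul]
          gcongr
          exact_mod_cast h4
  have hsum : ∀ f : Grid d (2 ^ k) → ℝ, ∑ s ∈ T, f s = ∑ R ∈ P.parts, ∑ s ∈ R, f s := fun f => by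
    conv_lhs => rw [← P.biUnion_parts]
    rw [Finset.sum_biUnion P.disjoint]
    rfl
  rw [hsum, hsum]
  refine (Finset.sum_le_sum hR).trans_eq ?_
  rw [Finset.sum_add_distrib, Finset.sum_const, nsmul_eq_mul]

/-- The right side is `3 + 3k log 2`, and `3 log 2 > 2`. -/
lemma two_mul_add_one_le_log (k : ℕ) :
    (2 * k + 1 : ℝ) ≤ 3 * Real.log (Real.exp 1 * ((2 ^ k : ℕ) : ℝ)) := by
  rw [Real.log_mul (Real.exp_pos 1).ne' (by positivity), Real.log_exp]
  push_cast
  rw [Real.log_pow]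
  have := Real.log_two_gt_d9
  have hk : (0 : ℝ) ≤ k := Nat.cast_nonneg k
  nlinarith

theorem theorem4p1 :
    ∃ C : ℝ, 0 < C ∧
      ∀ (d k n N : ℕ), n = 2 ^ k → N = n ^ d →
      ∀ (Ω : Type*) [MeasurableSpace Ω] (μ : Measure Ω) [IsProbabilityMeasure μ]
        (θstar : Grid d (2 ^ k) → ℝ) (σ : ℝ) (ε : Grid d (2 ^ k) → Ω → ℝ)
        (y : Ω → Grid d (2 ^ k) → ℝ) (ρ : Ω → (Fin N ≃ Grid d (2 ^ k))) (lam : ℝ),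
        0 < σ →
        (∀ s, Measurable (ε s)) →
        iIndepFun ε μ →
        (∀ s, ∫ ω, ε s ω ∂μ = 0) →
        (∀ s, ∀ x : ℝ, 0 ≤ x →
          max (μ.real {ω | x ≤ ε s ω}) (μ.real {ω | ε s ω ≤ -x}) ≤ 2 * Real.exp (-x ^ 2 / 2)) →
        (∀ ω s, y ω s = θstar s + σ * ε s ω) →
        IsNonAnticipating μ ε y ρ →
        0 < lam →
        C * max (σ * Real.sqrt (Real.log N)) ‖θstar‖ ≤ lam →
        ∀ T : Finset (Grid d (2 ^ k)), T.Nonempty →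
          Integrable (fun ω => ∑ s ∈ T, (omadre lam (ρ ω) (y ω) s - θstar s) ^ 2) μ ∧
          ∀ (P : Finpartition T) (θ : Grid d (2 ^ k) → ℝ),
            IsRectangularPartition P → IsPiecewiseConstant P θ →
            ∫ ω, (1 / (T.card : ℝ)) * ∑ s ∈ T, (omadre lam (ρ ω) (y ω) s - θstar s) ^ 2 ∂μ
              ≤ (1 / (T.card : ℝ)) * ∑ s ∈ T, (θstar s - θ s) ^ 2
                + C * lam ^ 2 * ((P.parts.card : ℝ) / (T.card : ℝ))
                    * (3 * Real.log (Real.exp 1 * n)) ^ d * Real.log (2 ^ d * N)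
                + (σ ^ 2 + lam ^ 2) / (T.card : ℝ) ^ 2 := by
  refine ⟨100, by norm_num, ?_⟩
  intro d k n N hn hN Ω _ μ _ θstar σ ε y ρ lam hσ hε _ hmean htail hy hρ hlam hC T hT
  have hC1 : 100 * (σ * Real.sqrt (Real.log N)) ≤ lam :=
    (mul_le_mul_of_nonneg_left (le_max_left _ _) (by norm_num)).trans hC
  have hC2 : 100 * ‖θstar‖ ≤ lam :=
    (mul_le_mul_of_nonneg_left (le_max_right _ _) (by norm_num)).trans hC
  have hθs : ∀ s, 100 * |θstar s| ≤ lam := fun s =>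
    (mul_le_mul_of_nonneg_left (norm_le_pi_norm θstar s) (by norm_num)).trans hC2
  have hθs' : ∀ s, |θstar s| ≤ lam := fun s => by linarith [hθs s, abs_nonneg (θstar s)]
  have hym : ∀ s, Measurable fun ω => y ω s := fun s => by
    simp only [hy]
    exact ((hε s).const_mul σ).const_add _
  have hint : ∀ s, Integrable (fun ω => (omadre lam (ρ ω) (y ω) s - θstar s) ^ 2) μ := fun s =>
    integrable_aggregate_sub_sq _ hlam.le hym hρ.measurable s (hθs' s)
  refine ⟨integrable_finsetSum _ fun s _ => hint s, fun P θ hP hθ => ?_⟩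
  have hTc : 0 < (T.card : ℝ) := by exact_mod_cast hT.card_pos
  have hcard : Fintype.card (Grid d (2 ^ k)) = N := by simp [hN, hn]
  have hN1 : 1 ≤ N := by rw [hN, hn]; exact Nat.one_le_pow _ _ (by positivity)
  have hlogn : 0 ≤ 3 * Real.log (Real.exp 1 * n) := by
    rw [hn]
    exact le_trans (by positivity) (two_mul_add_one_le_log k)
  have hlog0 : 0 ≤ Real.log (2 ^ d * N) := by
    have := Real.log_natCast_nonneg (2 ^ d * N)
    push_cast at this
    exact this
  rw [integral_const_mul, integral_finsetSum _ fun s _ => hint s]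
  -- If `N = 1` then `log N = 0` and `lam` gives no control of `σ`. But the only prediction is zero,
  -- with error `θ*² ≤ lam²`, which the last term of the bound absorbs.
  rcases hN1.eq_or_lt with hN1 | hN2
  · have hT1 : T.card = 1 := by
      have := Finset.card_le_univ T
      have := hT.card_pos
      omega
    have hz : ∀ s, ∫ ω, (omadre lam (ρ ω) (y ω) s - θstar s) ^ 2 ∂μ = (θstar s) ^ 2 := by
      intro s
      have : ∀ ω, omadre lam (ρ ω) (y ω) s = 0 := fun ω =>
        aggregatePrediction_meanRule_first _ hlam.le _ _ (by omega)
      simp [this]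
    obtain ⟨s₀, hs₀⟩ := Finset.card_eq_one.1 hT1
    have h1 : θstar s₀ ^ 2 ≤ lam ^ 2 := sq_le_sq' (abs_le.1 (hθs' s₀)).1 (abs_le.1 (hθs' s₀)).2
    have h2 : 0 ≤ 100 * lam ^ 2 * ((P.parts.card : ℝ) / (T.card : ℝ))
        * (3 * Real.log (Real.exp 1 * n)) ^ d * Real.log (2 ^ d * N) := by positivity
    have h3 : 0 ≤ (1 / (T.card : ℝ)) * ∑ s ∈ T, (θstar s - θ s) ^ 2 := by positivity
    have h4 : (1 / (T.card : ℝ)) * ∑ s ∈ T, ∫ ω, (omadre lam (ρ ω) (y ω) s - θstar s) ^ 2 ∂μ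
        = θstar s₀ ^ 2 := by
      simp [hz, hT1]
      simp [hs₀]
    have h5 : (σ ^ 2 + lam ^ 2) / (T.card : ℝ) ^ 2 = σ ^ 2 + lam ^ 2 := by simp [hT1]
    rw [h4, h5]
    nlinarith [sq_nonneg σ]
  have hd : 1 ≤ d := by
    by_contra hd
    have : d = 0 := by omega
    simp [this] at hN
    omega
  have hN2' : (2 : ℝ) ≤ N := by exact_mod_cast hN2
  have hNlog : 0 < Real.log N := Real.log_pos (by linarith)
  have hL : Real.log (2 ^ d * N) = d * Real.log 2 + Real.log N := by
    rw [Real.log_mul (by positivity) (by linarith), Real.log_pow]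
  have hd' : (1 : ℝ) ≤ d := by exact_mod_cast hd
  have hlog2N : Real.log 2 ≤ Real.log N := Real.log_le_log (by norm_num) hN2'
  have hL1 : 1 ≤ Real.log (2 ^ d * N) := by
    have := Real.log_two_gt_d9
    nlinarith
  have hLN : Real.log N ≤ Real.log (2 ^ d * N) := by
    have := Real.log_two_gt_d9
    nlinarith
  set L := Real.log (2 ^ d * N) with hLdef
  -- Here `88 = 8 + 4 + 76`: both logarithms in the single-rectangle bound are at most `L`, and `L ≥
  -- 1` absorbs the constant 76.
  set κ : ℝ := 88 * lam ^ 2 * L with hκ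
  have hκ0 : 0 ≤ κ := by positivity
  have hSc : Real.log (dyadicRectangles d k).card ≤ L := by
    rcases Nat.eq_zero_or_pos (dyadicRectangles d k).card with h0 | h0
    · simp only [h0, Nat.cast_zero, Real.log_zero]
      exact hlog0
    refine Real.log_le_log (by exact_mod_cast h0) ?_
    have h1 := card_dyadicRectangles_le d k
    rw [mul_pow, show (2 ^ k) ^ d = N by rw [hN, hn]] at h1
    exact_mod_cast h1
  have hS : ∀ S ∈ dyadicRectangles d k, ∀ c : ℝ,
      ∑ s ∈ S, ∫ ω, (omadre lam (ρ ω) (y ω) s - θstar s) ^ 2 ∂μ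
        ≤ ∑ s ∈ S, (θstar s - c) ^ 2 + κ := by
    intro S hS c
    have hsq : Real.sqrt (Real.log N) ^ 2 = Real.log N := Real.sq_sqrt hNlog.le
    -- Since `log N ≥ log 2 > 1/4`. Hence the lower bound on `lam` also yields `σ ≤ lam`.
    have hsqrt : 1 / 2 ≤ Real.sqrt (Real.log N) := by
      refine Real.le_sqrt_of_sq_le ?_
      have := Real.log_two_gt_d9
      linarith
    -- The choice of `M` makes `N² exp(-M²/2)` equal to one.
    have h1 := integral_sum_aggregate_sub_sq_le (𝒮 := dyadicRectangles d k)
      (M := 2 * Real.sqrt (Real.log N)) (θ := θstar) hcard hlam hσ (by nlinarith)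
      (by positivity)
      (by
        rw [mul_pow, hsq, show -(2 ^ 2 * Real.log N) / 2 = -(2 * Real.log N) by ring,
          Real.exp_neg, two_mul, Real.exp_add, Real.exp_log (by linarith), pow_two]
        exact (mul_inv_cancel₀ (by positivity)).le)
      (fun s => by nlinarith [hθs s, mul_pos hσ (lt_of_lt_of_le (by norm_num) hsqrt)])
      hε hmean
      (fun s x hx => (measureReal_le_abs_le (htail s x hx)).trans_eq (by ring)) hy hρ hS
      (abs_truncate_le hlam.le c)
    rw [integral_finsetSum] at h1
    · refine h1.trans (add_le_add (Finset.sum_le_sum fun s _ => ?_) ?_)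
      -- The bound was applied to the truncation of `c`, because `c` may be large. Truncation is a
      -- contraction fixing `θ*`, so this only brings the constant closer to `θ*`.
      · have h2 := abs_truncate_sub_truncate_le lam (θstar s) c
        rw [truncate_eq_self (hθs' s)] at h2
        exact sq_le_sq.2 h2
      · rw [hκ]
        nlinarith [sq_nonneg lam]
    · exact fun s _ => hint s
  have hfin := sum_le_of_dyadicRectangles P hP hθ hκ0 hS
  have hpow : ((2 * k + 1 : ℝ)) ^ d ≤ (3 * Real.log (Real.exp 1 * n)) ^ d := by
    rw [hn]
    exact pow_le_pow_left₀ (by positivity) (two_mul_add_one_le_log k) d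
  have h6 : (P.parts.card : ℝ) * ((2 * k + 1) ^ d * κ)
      ≤ P.parts.card * ((3 * Real.log (Real.exp 1 * n)) ^ d * (100 * lam ^ 2 * L)) := by
    have : κ ≤ 100 * lam ^ 2 * L := by
      rw [hκ]
      gcongr
      norm_num
    gcongr
  have h7 : (0 : ℝ) ≤ (σ ^ 2 + lam ^ 2) / (T.card : ℝ) ^ 2 := by positivity
  have h8 := mul_le_mul_of_nonneg_left (hfin.trans (add_le_add_right h6 _))
    (by positivity : 0 ≤ 1 / (T.card : ℝ))
  refine h8.trans ?_
  rw [mul_add]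
  have h9 : 1 / (T.card : ℝ) * (P.parts.card
      * ((3 * Real.log (Real.exp 1 * n)) ^ d * (100 * lam ^ 2 * L)))
      = 100 * lam ^ 2 * ((P.parts.card : ℝ) / (T.card : ℝ))
        * (3 * Real.log (Real.exp 1 * n)) ^ d * L := by
    field_simp
  linarith
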